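/- A Nevanlinna function is a function $m$ that is holomorphic at least on $\mathbb C\setminus\mathbb R$ and satisfies $m(\bar z)=\overline{m(z)}$ and $\operatorname{Im} m(z)\ge 0$ for all $z$ with $\operatorname{Im} z>0$. It is a Stieltjes function if it is holomorphic on $\mathbb C\setminus[0,+\infty)$ and takes nonnegative values on $(-\infty,0)$. For a Nevanlinna function $m$ let $\mathcal H(m)$ be the reproducing kernel Hilbert space of functions on $\mathbb C\setminus\mathbb R$ with the (nonnegative) kernel $$K_m(z,w)=\frac{m(z)-\overline{m(w)}}{z-\bar w}\quad (z\ne\bar w),\qquad K_m(\bar w,w)=m'(\bar w),$$ and put $w_m(y)=1/\operatorname{Im} m(iy)$ for $y>0$. The function $m$ has the $B_\infty$-property if $h\mapsto \bigl(y\mapsto h(iy)\bigr)$ is a bounded operator from $\mathcal H(m)$ into the weighted space $L^2_{w_m}(1,\infty)$. Theorem. Let $m$ be a Stieltjes function, and suppose that there exist $\alpha\in(0,1)$ and $C>0$ such that for every $z\in\mathbb C\setminus\mathbb R$ $$ m(rz)\sim \frac{C}{(-rz)^{\alpha}}\qquad\text{as } r\to+\infty, $$ that is, the quotient of the two sides tends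 to $1$, where $\zeta^\alpha$ is the principal branch. Then $m$ has the $B_\infty$-property (in particular, the kernel $K_m$ is nonnegative). Moreover, whenever $$m(z)=\gamma+\int_{[0,+\infty)}\frac{d\sigma(t)}{t-z}\qquad (z\in\mathbb C\setminus[0,+\infty))$$ with $\gamma\ge 0$ and a measure $\sigma$ on $[0,+\infty)$ such that $\int_{[0,+\infty)}\frac{d\sigma(t)}{1+t}<+\infty$, the integral operator $$ f\mapsto \Bigl(y\mapsto\int_{[0,+\infty)}\frac{f(x)}{x+y}\,d\sigma(x)\Bigr) $$ is bounded from $L^2_\sigma$ into $L^2_{w_m}(1,\infty)$. -/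

import Mathlib

open Filter Topology MeasureTheory

noncomputable section

/-- Nevanlinna functions. Only the values of `m` off the real line matter here. -/
structure IsNevanlinna (m : ℂ → ℂ) : Prop where
  differentiableOn : DifferentiableOn ℂ m {z : ℂ | z.im ≠ 0}
  symm : ∀ z : ℂ, 0 < z.im → m (starRingEnd ℂ z) = starRingEnd ℂ (m z)
  im_nonneg : ∀ z : ℂ, 0 < z.im → 0 ≤ (m z).im

/-- The slit plane `ℂ \ [0, ∞)`. -/
def cutPlane : Set ℂ := {z : ℂ | ¬ (z.im = 0 ∧ 0 ≤ z.re)}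

/-- Stieltjes functions: Nevanlinna functions holomorphic on `ℂ \ [0, ∞)` that take nonnegative
real values on the open negative half-line. -/
structure IsStieltjes (m : ℂ → ℂ) : Prop extends IsNevanlinna m where
  differentiableOn_cutPlane : DifferentiableOn ℂ m cutPlane
  nonneg : ∀ x : ℝ, x < 0 → (m x).im = 0 ∧ 0 ≤ (m x).re

/-- The set `ℂ \ ℝ`. -/
abbrev NonrealPlane : Type := {z : ℂ // z.im ≠ 0}

open Classical in
/-- The kernel `K_m(z, w) = (m z - conj (m w)) / (z - conj w)`, continued to `z = conj w` by
its limit `m' z`. -/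
def nevanlinnaKernelFun (m : ℂ → ℂ) (z w : ℂ) : ℂ :=
  if z = starRingEnd ℂ w then deriv m z
  else (m z - starRingEnd ℂ (m w)) / (z - starRingEnd ℂ w)

/-- The kernel `K_m` on `ℂ \ ℝ`, its values being regarded as operators `ℂ → ℂ`. -/
def nevanlinnaKernel (m : ℂ → ℂ) : Matrix NonrealPlane NonrealPlane (ℂ →L[ℂ] ℂ) :=
  Matrix.of fun z w => nevanlinnaKernelFun m z w • ContinuousLinearMap.id ℂ ℂ

/-- The weight `w_m(y) = 1 / Im m(iy)`. -/
def weight (m : ℂ → ℂ) (y : ℝ) : ℝ := 1 / (m (y * Complex.I)).im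

/-- The measure `w_m(y) dy` on `(1, ∞)`. -/
def weightMeasure (m : ℂ → ℂ) : Measure ℝ :=
  (volume.restrict (Set.Ioi 1)).withDensity fun y => ENNReal.ofReal (weight m y)

/-- The point `iy` of `ℂ \ ℝ`, for `y > 1`. -/
def imagPoint (y : ℝ) (hy : 1 < y) : NonrealPlane :=
  ⟨y * Complex.I, by simpa using (zero_lt_one.trans hy).ne'⟩

/-- The `B_∞`-property: with `H(m)` the reproducing kernel Hilbert space of the (nonnegative)
kernel `K_m`, the map `h ↦ (y ↦ h (iy))` is a bounded operator from `H(m)` into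
`L²_{w_m}(1, ∞)`. -/
def HasBInftyProperty (m : ℂ → ℂ) : Prop :=
  ∃ _ : Fact (nevanlinnaKernel m).PosSemidef,
    ∃ G : RKHS.OfKernel (nevanlinnaKernel m) →L[ℂ] Lp ℂ 2 (weightMeasure m),
      ∀ h : RKHS.OfKernel (nevanlinnaKernel m),
        ∀ᵐ y ∂(weightMeasure m), ∀ hy : 1 < y, G h y = h (imagPoint y hy)

/-- `m z = γ + ∫_{[0, ∞)} dσ(t) / (t - z)` on `ℂ \ [0, ∞)`, with `γ ≥ 0` and a measure `σ` on
`[0, ∞)` such that `∫ dσ(t) / (1 + t) < ∞`. -/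
structure IsStieltjesRepresentation (m : ℂ → ℂ) (γ : ℝ) (σ : Measure ℝ) : Prop where
  nonneg : 0 ≤ γ
  support : σ (Set.Iio 0) = 0
  integrable : Integrable (fun t : ℝ => 1 / (1 + t)) σ
  eq_integral : ∀ z ∈ cutPlane, m z = γ + ∫ t : ℝ, 1 / ((t : ℂ) - z) ∂σ

/-- The integral operator `f ↦ (y ↦ ∫ f(x) / (x + y) dσ(x))` is bounded from `L²_σ` into
`L²_{w_m}(1, ∞)`. -/
def StieltjesOperatorBounded (m : ℂ → ℂ) (σ : Measure ℝ) : Prop :=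
  ∃ H : Lp ℂ 2 σ →L[ℂ] Lp ℂ 2 (weightMeasure m),
    ∀ f : Lp ℂ 2 σ, ∀ᵐ y ∂(weightMeasure m), H f y = ∫ x : ℝ, f x / ((x : ℂ) + y) ∂σ

end

/-! ### Cauchy integrals on a circle -/

noncomputable section

open Complex Metric ComplexConjugate

/-! Both assertions concern an operator `G` of the form `h ↦ (y ↦ ⟪k y, h⟫)`. For the `B_∞`-property
`k y` is the reproducing kernel at `iy`; for the integral operator it is the function `x ↦ 1 / (x +
y)` in `L²_σ`. Since `G G*` is the integral operator with the Gram kernel `⟪k y, k s⟫`, boundedness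
follows from Schur's test for that kernel (`exists_continuousLinearMap_of_schur`).

Along the imaginary axis `y ^ α * m (iy)` tends to `C * exp (iπα/2)`, whose imaginary part is
positive. Hence `m (iy) = O(y ^ (-α))` and `w_m(y) = O(y ^ α)` on `[1, ∞)`, and both Gram kernels
are `O((y ^ (-α) + s ^ (-α)) / (y + s))`. For `K_m` this is the triangle inequality; for `L²_σ` it
rests on `∫ dσ(t) / (t + y) ≤ 2 |m (iy)|`. Schur's test with the function `s ^ (-(1 + α) / 2)` then
applies to both (`exists_continuousLinearMap_weightMeasure`).

Nonnegativity of `K_m` is obtained from Cauchy's formula on discs exhausting the upper half-plane: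
the Pick kernel of a disc is a Gram kernel on its boundary circle with density `2 Im m ≥ 0`.
Suitable vectors for points of the lower half-plane extend this to `ℂ \ ℝ`, and `K_m` is the limit
of these Gram kernels (`tendsto_pickKernel`). -/

lemma intervalIntegral_conj_eq (f : ℝ → ℂ) (a b : ℝ) :
    ∫ x in a..b, conj (f x) = conj (∫ x in a..b, f x) := by
  simp only [intervalIntegral, integral_conj, map_sub]

lemma circleIntegral_eq_integral_sub_mul (c : ℂ) (r : ℝ) (f : ℂ → ℂ) :
    (∮ u in C(c, r), f u) =
      I * ∫ θ in 0..2 * Real.pi, (circleMap c r θ - c) * f (circleMap c r θ) := by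
  rw [circleIntegral, ← intervalIntegral.integral_const_mul]
  congr 1
  ext θ
  simp only [deriv_circleMap, smul_eq_mul, circleMap_sub_center]
  ring

lemma integral_sub_mul_eq_zero {c : ℂ} {r : ℝ} (hr : 0 < r) {f : ℂ → ℂ}
    (hf : DiffContOnCl ℂ f (ball c r)) :
    ∫ θ in 0..2 * Real.pi, (circleMap c r θ - c) * f (circleMap c r θ) = 0 := by
  have h := hf.circleIntegral_eq_zero hr.le
  rw [circleIntegral_eq_integral_sub_mul] at h
  exact (mul_eq_zero.mp h).resolve_left I_ne_zero

lemma integral_sub_mul_div_sub {c z : ℂ} {r : ℝ} {f : ℂ → ℂ}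
    (hf : DiffContOnCl ℂ f (ball c r)) (hz : z ∈ ball c r) :
    ∫ θ in 0..2 * Real.pi,
      (circleMap c r θ - c) * (f (circleMap c r θ) / (circleMap c r θ - z)) =
      2 * Real.pi * f z := by
  have h := hf.circleIntegral_sub_inv_smul hz
  have h2 : (∮ u in C(c, r), (u - z)⁻¹ • f u) = ∮ u in C(c, r), f u / (u - z) := by
    congr 1; ext u; rw [smul_eq_mul, div_eq_inv_mul]
  rw [h2, circleIntegral_eq_integral_sub_mul, smul_eq_mul] at h
  apply mul_left_cancel₀ I_ne_zero
  rw [h]; ring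

lemma circleMap_sub_ne_zero {c z : ℂ} {r : ℝ} (hz : z ∈ ball c r) (θ : ℝ) :
    circleMap c r θ - z ≠ 0 := sub_ne_zero.2 (circleMap_ne_mem_ball hz θ)

/-- Substituting `f u = f w + (u - w) * dslope f w u` leaves Cauchy's formula for `dslope f w` and a
multiple of the integral of `1 / ((u - z) (u - w))`. The latter vanishes: by partial fractions if `z
≠ w`, as the derivative of a constant if `z = w`. -/
lemma integral_sub_mul_div_sub_mul_sub {c z w : ℂ} {r : ℝ} {f : ℂ → ℂ}
    (hf : DiffContOnCl ℂ f (ball c r)) (hz : z ∈ ball c r) (hw : w ∈ ball c r) :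
    ∫ θ in 0..2 * Real.pi, (circleMap c r θ - c) *
      (f (circleMap c r θ) / ((circleMap c r θ - z) * (circleMap c r θ - w))) =
      2 * Real.pi * dslope f w z := by
  have hr : 0 < r := dist_nonneg.trans_lt (mem_ball.1 hz)
  have hwnhds : ball c r ∈ 𝓝 w := isOpen_ball.mem_nhds hw
  have hcont : ContinuousOn (dslope f w) (closedBall c r) :=
    (continuousOn_dslope (closedBall_mem_nhds_of_mem hw)).2
      ⟨closure_ball c hr.ne' ▸ hf.continuousOn, hf.differentiableAt isOpen_ball hw⟩
  have hd : DiffContOnCl ℂ (dslope f w) (ball c r) :=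
    ⟨(differentiableOn_dslope hwnhds).2 hf.differentiableOn, by
      rwa [closure_ball c hr.ne']⟩
  have h1 := integral_sub_mul_div_sub hd hz
  have hcst : DiffContOnCl ℂ (fun _ : ℂ => (1 : ℂ)) (ball c r) := diffContOnCl_const
  have hcu : Continuous (circleMap c r) := continuous_circleMap c r
  have hzero : ∫ θ in 0..2 * Real.pi, (circleMap c r θ - c) *
      (1 / ((circleMap c r θ - z) * (circleMap c r θ - w))) = 0 := by
    by_cases hzw : z = w
    · subst hzw
      have h := Complex.two_pi_I_inv_smul_circleIntegral_sub_sq_inv_smul_of_differentiable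
        isOpen_univ (Set.subset_univ (closedBall c r))
        (f := fun _ : ℂ => (1 : ℂ)) (by fun_prop) hz
      simp only [deriv_const, smul_eq_mul, mul_one, mul_eq_zero, inv_eq_zero] at h
      have h' := h.resolve_left (by simp [Real.pi_ne_zero])
      rw [circleIntegral_eq_integral_sub_mul] at h'
      have h'' := (mul_eq_zero.mp h').resolve_left I_ne_zero
      rw [← h'']
      simp only [pow_two, one_div]
    · have e : ∀ θ : ℝ, (circleMap c r θ - c) *
          (1 / ((circleMap c r θ - z) * (circleMap c r θ - w))) =
          (z - w)⁻¹ * ((circleMap c r θ - c) * (1 / (circleMap c r θ - z)) -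
            (circleMap c r θ - c) * (1 / (circleMap c r θ - w))) := fun θ => by
        have h1 := circleMap_sub_ne_zero hz θ
        have h2 := circleMap_sub_ne_zero hw θ
        have h3 := sub_ne_zero.2 hzw
        field_simp
        ring
      simp_rw [e]
      rw [intervalIntegral.integral_const_mul, intervalIntegral.integral_sub,
        integral_sub_mul_div_sub hcst hz, integral_sub_mul_div_sub hcst hw]
      · simp
      all_goals
        refine Continuous.intervalIntegrable ?_ _ _
        refine (by fun_prop : Continuous fun θ => circleMap c r θ - c).mul
          (continuous_const.div (by fun_prop) (circleMap_sub_ne_zero (by assumption)))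
  have e : ∀ θ : ℝ, (circleMap c r θ - c) *
      (f (circleMap c r θ) / ((circleMap c r θ - z) * (circleMap c r θ - w))) =
      (circleMap c r θ - c) * (dslope f w (circleMap c r θ) / (circleMap c r θ - z)) +
      f w * ((circleMap c r θ - c) *
      (1 / ((circleMap c r θ - z) * (circleMap c r θ - w)))) := fun θ => by
    have h1 := circleMap_sub_ne_zero hz θ
    have h2 := circleMap_sub_ne_zero hw θ
    rw [dslope_of_ne _ (sub_ne_zero.1 h2), slope_def_field]
    field_simp
    ring
  simp_rw [e]
  rw [intervalIntegral.integral_add, intervalIntegral.integral_const_mul, h1, hzero, mul_zero,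
    add_zero]
  · refine Continuous.intervalIntegrable ?_ _ _
    refine (by fun_prop : Continuous fun θ => circleMap c r θ - c).mul
      (Continuous.div ?_ (by fun_prop) (circleMap_sub_ne_zero hz))
    exact hcont.comp_continuous hcu (circleMap_mem_closedBall c hr.le)
  · refine Continuous.intervalIntegrable ?_ _ _
    refine continuous_const.mul <|
      (by fun_prop : Continuous fun θ => circleMap c r θ - c).mul
      (continuous_const.div (by fun_prop) fun θ =>
        mul_ne_zero (circleMap_sub_ne_zero hz θ) (circleMap_sub_ne_zero hw θ))

/-- On the circle `conj (u - c) = r² / (u - c)`. This turns antiholomorphic factors into rational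
functions of `u`, so that Cauchy's formula applies to them. -/
lemma conj_circleMap_sub {c w : ℂ} {r : ℝ} (hr : 0 < r) (θ : ℝ) :
    conj (circleMap c r θ - w) =
      (r ^ 2 - conj (w - c) * (circleMap c r θ - c)) / (circleMap c r θ - c) := by
  have h0 : circleMap c r θ - c ≠ 0 := circleMap_sub_ne_zero (mem_ball_self hr) θ
  rw [eq_div_iff h0]
  have h : (circleMap c r θ - c) * conj (circleMap c r θ - c) = r ^ 2 := by
    rw [mul_conj, circleMap_sub_center, normSq_eq_norm_sq, norm_circleMap_zero, sq_abs]
    norm_cast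
  have : conj (circleMap c r θ - w) = conj (circleMap c r θ - c) - conj (w - c) := by
    rw [← map_sub]; congr 1; ring
  rw [this, ← h]; ring

lemma sq_sub_conj_mul_ne_zero {c w u : ℂ} {r : ℝ} (hw : w ∈ ball c r)
    (hu : u ∈ closedBall c r) : (r : ℂ) ^ 2 - conj (w - c) * (u - c) ≠ 0 := by
  intro h
  have hr : 0 < r := dist_nonneg.trans_lt (mem_ball.1 hw)
  rw [mem_ball, dist_eq_norm] at hw
  rw [mem_closedBall, dist_eq_norm] at hu
  have h2 : ‖(r : ℂ) ^ 2‖ = ‖w - c‖ * ‖u - c‖ := by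
    rw [sub_eq_zero.1 h, norm_mul, RCLike.norm_conj]
  rw [norm_pow, norm_real, Real.norm_of_nonneg hr.le] at h2
  have : ‖w - c‖ * ‖u - c‖ ≤ ‖w - c‖ * r := by gcongr
  nlinarith

lemma diffContOnCl_div_sq_sub {c w : ℂ} {r : ℝ} {f : ℂ → ℂ}
    (hf : DiffContOnCl ℂ f (ball c r)) (hw : w ∈ ball c r) :
    DiffContOnCl ℂ (fun u => f u / ((r : ℂ) ^ 2 - conj (w - c) * (u - c))) (ball c r) := by
  have hr : 0 < r := dist_nonneg.trans_lt (mem_ball.1 hw)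
  refine ⟨hf.differentiableOn.div (by fun_prop) fun u hu =>
    sq_sub_conj_mul_ne_zero hw (ball_subset_closedBall hu),
    hf.continuousOn.div (by fun_prop) fun u hu => ?_⟩
  rw [closure_ball c hr.ne'] at hu
  exact sq_sub_conj_mul_ne_zero hw hu

lemma integral_div_sub_mul_conj_sub {c z w : ℂ} {r : ℝ} {f : ℂ → ℂ}
    (hf : DiffContOnCl ℂ f (ball c r)) (hz : z ∈ ball c r) (hw : w ∈ ball c r) :
    ∫ θ in 0..2 * Real.pi,
      f (circleMap c r θ) / ((circleMap c r θ - z) * conj (circleMap c r θ - w)) =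
      2 * Real.pi * (f z / (r ^ 2 - conj (w - c) * (z - c))) := by
  have hr : 0 < r := dist_nonneg.trans_lt (mem_ball.1 hw)
  rw [← integral_sub_mul_div_sub (diffContOnCl_div_sq_sub hf hw) hz]
  congr 1
  ext θ
  rw [conj_circleMap_sub hr]
  have h0 : circleMap c r θ - c ≠ 0 := circleMap_sub_ne_zero (mem_ball_self hr) θ
  have h1 := circleMap_sub_ne_zero hz θ
  have h2 := sq_sub_conj_mul_ne_zero hw (circleMap_mem_closedBall c hr.le θ)
  field_simp

lemma ofReal_two_mul_im (a : ℂ) : ((2 * a.im : ℝ) : ℂ) = -I * a + conj (-I * a) := by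
  apply Complex.ext
  · simp; ring
  · simp

lemma DiffContOnCl.continuous_comp_circleMap {c : ℂ} {r : ℝ} (hr : 0 < r) {f : ℂ → ℂ}
    (hf : DiffContOnCl ℂ f (ball c r)) : Continuous fun θ => f (circleMap c r θ) :=
  (closure_ball c hr.ne' ▸ hf.continuousOn : ContinuousOn f (closedBall c r)).comp_continuous
    (continuous_circleMap c r) (circleMap_mem_closedBall c hr.le)

/-- With `2 Im f = -i f + i conj f`, each half is a Cauchy integral, the second being the conjugate
of the first with `z` and `w` exchanged. The result exhibits the Pick kernel of the disc as a Gram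
kernel with density `Im f`. -/
lemma integral_im_div_sub_mul_conj_sub {c z w : ℂ} {r : ℝ} {f : ℂ → ℂ}
    (hf : DiffContOnCl ℂ f (ball c r)) (hz : z ∈ ball c r) (hw : w ∈ ball c r) :
    ∫ θ in 0..2 * Real.pi, ((2 * (f (circleMap c r θ)).im : ℝ) : ℂ) *
      ((1 / (circleMap c r θ - z)) * conj (1 / (circleMap c r θ - w))) =
      -I * (2 * Real.pi) * ((f z - conj (f w)) / (r ^ 2 - (z - c) * conj (w - c))) := by
  have hr : 0 < r := dist_nonneg.trans_lt (mem_ball.1 hw)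
  have hfc := hf.continuous_comp_circleMap hr
  have hconj := congrArg conj (integral_div_sub_mul_conj_sub hf hw hz)
  rw [← intervalIntegral_conj_eq] at hconj
  have e : ∀ θ : ℝ, ((2 * (f (circleMap c r θ)).im : ℝ) : ℂ) *
      ((1 / (circleMap c r θ - z)) * conj (1 / (circleMap c r θ - w))) =
      -I * (f (circleMap c r θ) / ((circleMap c r θ - z) * conj (circleMap c r θ - w))) +
      I * conj (f (circleMap c r θ) / ((circleMap c r θ - w) * conj (circleMap c r θ - z))) := by
    intro θ
    have h1 := circleMap_sub_ne_zero hz θ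
    have h2 := circleMap_sub_ne_zero hw θ
    have h3 : conj (circleMap c r θ - w) ≠ 0 := (map_ne_zero _).2 h2
    rw [ofReal_two_mul_im]
    simp only [map_div₀, map_mul, map_one, conj_conj, map_neg, conj_I]
    field_simp
  have hci : ∀ z w, z ∈ ball c r → w ∈ ball c r → Continuous fun θ : ℝ =>
      f (circleMap c r θ) / ((circleMap c r θ - z) * conj (circleMap c r θ - w)) := by
    intro z w hz hw
    refine hfc.div ?_ fun θ => mul_ne_zero (circleMap_sub_ne_zero hz θ)
      ((map_ne_zero _).2 (circleMap_sub_ne_zero hw θ))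
    exact Continuous.mul (by fun_prop) (Complex.continuous_conj.comp (by fun_prop))
  simp_rw [e]
  rw [intervalIntegral.integral_add, intervalIntegral.integral_const_mul,
    intervalIntegral.integral_const_mul, integral_div_sub_mul_conj_sub hf hz hw, hconj]
  · simp only [map_div₀, map_mul, map_sub, conj_conj, map_pow, conj_ofReal, map_ofNat]
    ring
  · exact (continuous_const.mul (hci z w hz hw)).intervalIntegrable _ _
  · exact (continuous_const.mul
      (Complex.continuous_conj.comp (hci w z hw hz))).intervalIntegrable _ _

/-- The part with `conj f` drops out, being the conjugate of a closed contour integral of a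
holomorphic function. The factor `i (u - c) / r` is unimodular on the circle; it supplies the `u -
c` of the contour differential. -/
lemma integral_im_div_sub_mul_sub {c z w : ℂ} {r : ℝ} {f : ℂ → ℂ}
    (hf : DiffContOnCl ℂ f (ball c r)) (hz : z ∈ ball c r) (hw : w ∈ ball c r) :
    ∫ θ in 0..2 * Real.pi, ((2 * (f (circleMap c r θ)).im : ℝ) : ℂ) *
      ((1 / (circleMap c r θ - z)) *
        (I * (circleMap c r θ - c) / (r * (circleMap c r θ - w)))) =
      (2 * Real.pi) / r * dslope f w z := by
  have hr : 0 < r := dist_nonneg.trans_lt (mem_ball.1 hw)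
  have hr' : (r : ℂ) ≠ 0 := by exact_mod_cast hr.ne'
  have hfc := hf.continuous_comp_circleMap hr
  have hB := integral_sub_mul_div_sub_mul_sub hf hz hw
  have hZ := congrArg conj (integral_sub_mul_eq_zero hr
    (diffContOnCl_div_sq_sub (diffContOnCl_div_sq_sub hf hz) hw))
  rw [← intervalIntegral_conj_eq, map_zero] at hZ
  have e : ∀ θ : ℝ, ((2 * (f (circleMap c r θ)).im : ℝ) : ℂ) *
      ((1 / (circleMap c r θ - z)) *
        (I * (circleMap c r θ - c) / (r * (circleMap c r θ - w)))) =
      1 / r * ((circleMap c r θ - c) *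
      (f (circleMap c r θ) / ((circleMap c r θ - z) * (circleMap c r θ - w)))) +
      (-r) * conj ((circleMap c r θ - c) *
      (f (circleMap c r θ) / (r ^ 2 - conj (z - c) * (circleMap c r θ - c)) /
       (r ^ 2 - conj (w - c) * (circleMap c r θ - c)))) := by
    intro θ
    have h0 : circleMap c r θ - c ≠ 0 := circleMap_sub_ne_zero (mem_ball_self hr) θ
    have h1 := circleMap_sub_ne_zero hz θ
    have h2 := circleMap_sub_ne_zero hw θ
    have h3 := congrArg conj (conj_circleMap_sub (c := c) (w := z) hr θ)
    have h4 := congrArg conj (conj_circleMap_sub (c := c) (w := w) hr θ)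
    have h5 := conj_circleMap_sub (c := c) (w := c) hr θ
    have h0' : conj (circleMap c r θ - c) ≠ 0 := by simpa using h0
    rw [conj_conj, map_div₀, eq_div_iff h0'] at h3 h4
    rw [sub_self, map_zero, zero_mul, sub_zero, eq_div_iff h0] at h5
    rw [ofReal_two_mul_im]
    rw [map_mul conj (circleMap c r θ - c), map_div₀, map_div₀, ← h3, ← h4]
    simp only [map_mul, map_neg, conj_I]
    generalize circleMap c r θ - c = U at *
    generalize circleMap c r θ - z = P at *
    generalize circleMap c r θ - w = Q at *
    generalize conj U = V at *
    generalize f (circleMap c r θ) = F at *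
    generalize conj F = G at *
    field_simp
    linear_combination (-F * U * V + G * U * V) * I_sq - G * h5
  simp_rw [e]
  rw [intervalIntegral.integral_add, intervalIntegral.integral_const_mul,
    intervalIntegral.integral_const_mul, hB, hZ, mul_zero, add_zero]
  · ring
  · refine (continuous_const.mul <| Continuous.mul (by fun_prop) <| hfc.div (by fun_prop) fun θ =>
      mul_ne_zero (circleMap_sub_ne_zero hz θ) (circleMap_sub_ne_zero hw θ)).intervalIntegrable _ _
  · exact (continuous_const.mul <| Complex.continuous_conj.comp <| Continuous.mul (by fun_prop)
      ((diffContOnCl_div_sq_sub (diffContOnCl_div_sq_sub hf hz) hw).continuous_comp_circleMap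
        hr)).intervalIntegrable _ _

end

/-! ### Nonnegativity of the Nevanlinna kernel -/

noncomputable section

open Complex Metric ComplexConjugate

namespace IsNevanlinna

variable {m : ℂ → ℂ}

lemma apply_conj (hm : IsNevanlinna m) {z : ℂ} (hz : z.im ≠ 0) : m (conj z) = conj (m z) := by
  rcases hz.lt_or_gt with h | h
  · have := hm.symm (conj z) (by simpa using h)
    rw [conj_conj] at this
    rw [this, conj_conj]
  · exact hm.symm z h

lemma isOpen_im_ne_zero : IsOpen {z : ℂ | z.im ≠ 0} :=
  isOpen_ne_fun continuous_im continuous_const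

lemma deriv_apply_conj (hm : IsNevanlinna m) {z : ℂ} (hz : z.im ≠ 0) :
    deriv m (conj z) = conj (deriv m z) := by
  have h : conj ∘ m ∘ conj =ᶠ[𝓝 z] m := by
    filter_upwards [isOpen_im_ne_zero.mem_nhds hz] with w hw
    simp [hm.apply_conj hw]
  rw [← h.deriv_eq, deriv_conj_conj]
  simp

lemma kernelFun_conj_symm (hm : IsNevanlinna m) {z w : ℂ} (hz : z.im ≠ 0) :
    conj (nevanlinnaKernelFun m w z) = nevanlinnaKernelFun m z w := by
  unfold nevanlinnaKernelFun
  by_cases h : z = conj w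
  · have h' : w = conj z := by rw [h, conj_conj]
    rw [if_pos h, if_pos h', h', hm.deriv_apply_conj hz, conj_conj]
  · have h' : w ≠ conj z := fun h' => h (by rw [h', conj_conj])
    rw [if_neg h, if_neg h', map_div₀, map_sub, map_sub, conj_conj, conj_conj,
      ← neg_sub (m z), ← neg_sub z, neg_div_neg_eq]

lemma kernelFun_conj_conj (hm : IsNevanlinna m) {z w : ℂ} (hz : z.im ≠ 0) (hw : w.im ≠ 0)
    (h : z ≠ conj w) :
    nevanlinnaKernelFun m (conj w) (conj z) = nevanlinnaKernelFun m z w := by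
  unfold nevanlinnaKernelFun
  rw [if_neg h, conj_conj, if_neg h.symm, hm.apply_conj hw, hm.apply_conj hz, conj_conj,
    ← neg_sub (m z), ← neg_sub z, neg_div_neg_eq]

end IsNevanlinna

/-- The radius of the circle around `iR` along which the kernel `K_m` is approximated. -/
def pickRadius (R : ℝ) : ℝ := √(R ^ 2 - 1)

/-- The point with parameter `θ` of the circle around `iR` with radius `√(R² - 1)`. -/
def pickPoint (R θ : ℝ) : ℂ := circleMap (R * I) (pickRadius R) θ

open Classical in
/-- The function on the circle around `iR` that represents the point `z` of `ℂ \ ℝ`. -/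
def pickVec (R : ℝ) (z : ℂ) (θ : ℝ) : ℂ :=
  if 0 < z.im then 1 / (pickPoint R θ - z)
  else conj (I * (pickPoint R θ - R * I) / (pickRadius R * (pickPoint R θ - conj z)))

/-- An approximation of the kernel `K_m` by Gram matrices. -/
def pickKernel (m : ℂ → ℂ) (R : ℝ) (z w : ℂ) : ℂ :=
  R / (2 * Real.pi) * ∫ θ in 0..2 * Real.pi,
    ((2 * (m (pickPoint R θ)).im : ℝ) : ℂ) * (pickVec R z θ * conj (pickVec R w θ))

lemma pickRadius_sq {R : ℝ} (hR : 1 < R) : pickRadius R ^ 2 = R ^ 2 - 1 :=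
  Real.sq_sqrt (by nlinarith)

lemma pickRadius_pos {R : ℝ} (hR : 1 < R) : 0 < pickRadius R :=
  Real.sqrt_pos.2 (by nlinarith)

lemma pickRadius_lt {R : ℝ} (hR : 1 < R) : pickRadius R < R := by
  have := pickRadius_sq hR
  have := pickRadius_pos hR
  nlinarith

lemma closedBall_pickRadius_subset {R : ℝ} (hR : 1 < R) :
    closedBall (R * I : ℂ) (pickRadius R) ⊆ {z | 0 < z.im} := by
  intro z hz
  rw [mem_closedBall, dist_eq_norm] at hz
  have h1 := (abs_im_le_norm (z - R * I)).trans hz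
  have h2 := pickRadius_lt hR
  have h3 := (abs_le.1 h1).1
  simp only [sub_im, mul_im, ofReal_re, I_im, mul_one, ofReal_im, I_re, mul_zero, add_zero] at h3
  simp only [Set.mem_ofPred_eq]
  linarith

lemma pickPoint_im_pos {R : ℝ} (hR : 1 < R) (θ : ℝ) : 0 < (pickPoint R θ).im :=
  closedBall_pickRadius_subset hR (circleMap_mem_closedBall _ (pickRadius_pos hR).le θ)

/-- The inequality `|z - iR|² < R² - 1` amounts to `|z|² + 1 < 2 R Im z`. So these discs exhaust the
upper half-plane, while their closures stay inside it. -/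
lemma eventually_mem_ball_pickRadius {z : ℂ} (hz : 0 < z.im) :
    ∀ᶠ R : ℝ in atTop, z ∈ ball (R * I : ℂ) (pickRadius R) := by
  filter_upwards [eventually_gt_atTop 1, eventually_gt_atTop ((normSq z + 1) / (2 * z.im))]
    with R hR hR2
  rw [div_lt_iff₀ (by positivity)] at hR2
  rw [mem_ball, dist_eq_norm]
  refine lt_of_pow_lt_pow_left₀ 2 (pickRadius_pos hR).le ?_
  rw [pickRadius_sq hR, ← normSq_eq_norm_sq]
  simp only [normSq_apply, sub_re, mul_re, ofReal_re, I_re, mul_zero, ofReal_im, I_im, mul_one,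
    sub_im, mul_im, add_zero, sub_self, sub_zero] at hR2 ⊢
  nlinarith

lemma IsNevanlinna.diffContOnCl_ball {m : ℂ → ℂ} (hm : IsNevanlinna m) {R : ℝ} (hR : 1 < R) :
    DiffContOnCl ℂ m (ball (R * I : ℂ) (pickRadius R)) := by
  refine DifferentiableOn.diffContOnCl ?_
  rw [closure_ball _ (pickRadius_pos hR).ne']
  exact hm.differentiableOn.mono fun z hz => (closedBall_pickRadius_subset hR hz).ne'

lemma pickKernel_conj (m : ℂ → ℂ) (R : ℝ) (z w : ℂ) :
    conj (pickKernel m R w z) = pickKernel m R z w := by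
  unfold pickKernel
  rw [map_mul, ← intervalIntegral_conj_eq]
  simp only [map_mul, map_div₀, conj_ofReal, conj_conj, map_ofNat]
  simp only [mul_comm (conj (pickVec R w _))]

/-- The unimodular factors of the two vectors cancel in the product. -/
lemma pickKernel_conj_conj (m : ℂ → ℂ) {R : ℝ} (hR : 1 < R) {z w : ℂ} (hz : z.im < 0)
    (hw : w.im < 0) : pickKernel m R z w = pickKernel m R (conj w) (conj z) := by
  unfold pickKernel
  congr 2
  ext θ
  congr 1
  have hr := pickRadius_pos hR
  have hr' : (pickRadius R : ℂ) ≠ 0 := by exact_mod_cast hr.ne'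
  have h : (pickPoint R θ - R * I) * conj (pickPoint R θ - R * I) = pickRadius R ^ 2 := by
    rw [mul_conj, pickPoint, circleMap_sub_center, normSq_eq_norm_sq, norm_circleMap_zero, sq_abs]
    norm_cast
  simp only [pickVec, if_neg hz.not_gt, if_neg hw.not_gt, conj_im, neg_pos, hz, hw, if_true,
    conj_conj]
  simp only [map_mul, map_div₀, conj_I, conj_ofReal, map_one]
  generalize conj (pickPoint R θ - R * I) = V at *
  generalize (pickPoint R θ - R * I) = U at *
  rw [div_mul_div_comm, div_mul_div_comm, mul_mul_mul_comm (pickRadius R : ℂ),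
    show -I * V * (I * U) = pickRadius R * pickRadius R by
      linear_combination (-U * V) * I_sq + h, one_mul,
    ← div_div, div_self (mul_ne_zero hr' hr'), mul_comm (pickPoint R θ - conj w)]

lemma tendsto_div_sub_mul (a b : ℂ) (ha : a ≠ 0) :
    Tendsto (fun R : ℝ => (R : ℂ) / (R * a - b)) atTop (𝓝 (1 / a)) := by
  have h : Tendsto (fun R : ℝ => 1 / (a - b * ((R⁻¹ : ℝ) : ℂ))) atTop (𝓝 (1 / a)) := by
    have h0 : Tendsto (fun R : ℝ => ((R⁻¹ : ℝ) : ℂ)) atTop (𝓝 0) :=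
      (continuous_ofReal.tendsto' 0 0 ofReal_zero).comp tendsto_inv_atTop_zero
    have h1 := (tendsto_const_nhds (x := a)).sub ((tendsto_const_nhds (x := b)).mul h0)
    rw [mul_zero, sub_zero] at h1
    exact tendsto_const_nhds.div h1 ha
  refine h.congr' ?_
  filter_upwards [eventually_gt_atTop 0] with R hR
  have hR' : (R : ℂ) ≠ 0 := by exact_mod_cast hR.ne'
  rw [ofReal_inv, show (R : ℂ) * a - b = R * (a - b * (R : ℂ)⁻¹) by field_simp,
    ← div_div, div_self hR']

lemma tendsto_div_pickRadius : Tendsto (fun R : ℝ => (R : ℂ) / pickRadius R) atTop (𝓝 1) := by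
  have h0 : Tendsto (fun R : ℝ => 1 / √(1 - R⁻¹ ^ 2)) atTop (𝓝 1) := by
    have := (tendsto_const_nhds (x := (1 : ℝ))).sub (tendsto_inv_atTop_zero.pow 2)
    have h := tendsto_const_nhds (x := (1 : ℝ)) |>.div (this.sqrt) (by norm_num)
    simpa [Pi.div_def] using h
  have h1 : Tendsto (fun R : ℝ => ((R / pickRadius R : ℝ) : ℂ)) atTop (𝓝 1) := by
    refine (continuous_ofReal.tendsto' 1 1 ofReal_one).comp (h0.congr' ?_)
    filter_upwards [eventually_gt_atTop 1] with R hR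
    have hR' : 0 < R := by linarith
    rw [pickRadius, show R ^ 2 - 1 = R ^ 2 * (1 - R⁻¹ ^ 2) by field_simp,
      Real.sqrt_mul (by positivity), Real.sqrt_sq hR'.le]
    field_simp
  simpa using h1

/-- The disc denominator is `-i (R (z - conj w) - i (1 + z conj w))`. After division by `R`, the
normalisation in `pickKernel`, it tends to the half-plane denominator up to the factor `-i`. -/
lemma tendsto_pickKernel_of_pos_of_pos {m : ℂ → ℂ} (hm : IsNevanlinna m) {z w : ℂ}
    (hz : 0 < z.im) (hw : 0 < w.im) :
    Tendsto (fun R => pickKernel m R z w) atTop (𝓝 (nevanlinnaKernelFun m z w)) := by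
  have hne : z ≠ conj w := fun h => by
    have := congrArg im h
    rw [conj_im] at this
    linarith
  have hlim := (tendsto_div_sub_mul (z - conj w) (I * (1 + z * conj w)) (sub_ne_zero.2 hne)).const_mul
    (m z - conj (m w))
  rw [nevanlinnaKernelFun, if_neg hne, div_eq_mul_one_div]
  refine hlim.congr' ?_
  filter_upwards [eventually_gt_atTop 1, eventually_mem_ball_pickRadius hz,
    eventually_mem_ball_pickRadius hw] with R hR hzb hwb
  have key := integral_im_div_sub_mul_conj_sub (hm.diffContOnCl_ball hR) hzb hwb
  simp only [pickKernel, pickVec, if_pos hz, if_pos hw]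
  simp only [pickPoint] at key ⊢
  rw [key]
  have hsq : ((pickRadius R : ℝ) : ℂ) ^ 2 = R ^ 2 - 1 := by exact_mod_cast pickRadius_sq hR
  have hden : ((pickRadius R : ℝ) : ℂ) ^ 2 - (z - R * I) * conj (w - R * I) =
      -I * (R * (z - conj w) - I * (1 + z * conj w)) := by
    rw [hsq, map_sub, map_mul, conj_ofReal, conj_I]
    linear_combination (R ^ 2 - 1 - z * conj w) * I_sq
  rw [hden]
  have hpi : (Real.pi : ℂ) ≠ 0 := by exact_mod_cast Real.pi_ne_zero
  have hI := I_ne_zero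
  generalize (R : ℂ) * (z - conj w) - I * (1 + z * conj w) = D
  rcases eq_or_ne D 0 with rfl | hD
  · simp
  field_simp

/-- By the symmetry of `m` the kernel is the divided difference of `m` at `z` and `conj w`, the
derivative included. The approximation is exact up to the factor `R / √(R² - 1)`. -/
lemma tendsto_pickKernel_of_pos_of_neg {m : ℂ → ℂ} (hm : IsNevanlinna m) {z w : ℂ}
    (hz : 0 < z.im) (hw : w.im < 0) :
    Tendsto (fun R => pickKernel m R z w) atTop (𝓝 (nevanlinnaKernelFun m z w)) := by
  have hw' : 0 < (conj w).im := by simpa using hw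
  have hK : nevanlinnaKernelFun m z w = dslope m (conj w) z := by
    unfold nevanlinnaKernelFun
    split_ifs with h
    · rw [h, dslope_same]
    · rw [dslope_of_ne _ h, slope_def_field, hm.apply_conj hw.ne]
  have hlim := tendsto_div_pickRadius.mul_const (dslope m (conj w) z)
  rw [one_mul, ← hK] at hlim
  refine hlim.congr' ?_
  filter_upwards [eventually_gt_atTop 1, eventually_mem_ball_pickRadius hz,
    eventually_mem_ball_pickRadius hw'] with R hR hzb hwb
  have key := integral_im_div_sub_mul_sub (hm.diffContOnCl_ball hR) hzb hwb
  simp only [pickKernel, pickVec, if_pos hz, if_neg hw.not_gt, conj_conj]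
  simp only [pickPoint] at key ⊢
  rw [key, hK]
  have hpi : (Real.pi : ℂ) ≠ 0 := by exact_mod_cast Real.pi_ne_zero
  field_simp

lemma tendsto_pickKernel {m : ℂ → ℂ} (hm : IsNevanlinna m) {z w : ℂ}
    (hz : z.im ≠ 0) (hw : w.im ≠ 0) :
    Tendsto (fun R => pickKernel m R z w) atTop (𝓝 (nevanlinnaKernelFun m z w)) := by
  rcases hz.lt_or_gt with hz' | hz' <;> rcases hw.lt_or_gt with hw' | hw'
  · have hne : z ≠ conj w := fun h => by
      have := congrArg im h
      rw [conj_im] at this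
      linarith
    rw [← hm.kernelFun_conj_conj hz hw hne]
    refine (tendsto_pickKernel_of_pos_of_pos hm (z := conj w) (w := conj z) (by simpa using hw')
      (by simpa using hz')).congr' ?_
    filter_upwards [eventually_gt_atTop 1] with R hR
    rw [pickKernel_conj_conj m hR hz' hw']
  · rw [← hm.kernelFun_conj_symm hz]
    simp_rw [← pickKernel_conj m _ z w]
    exact (Complex.continuous_conj.tendsto _).comp (tendsto_pickKernel_of_pos_of_neg hm hw' hz')
  · exact tendsto_pickKernel_of_pos_of_neg hm hz' hw'
  · exact tendsto_pickKernel_of_pos_of_pos hm hz' hw'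

lemma eventually_continuous_pickVec {z : ℂ} (hz : z.im ≠ 0) :
    ∀ᶠ R : ℝ in atTop, Continuous (pickVec R z) := by
  have hp : ∀ R, Continuous (pickPoint R) := fun R => continuous_circleMap _ _
  rcases hz.lt_or_gt with h | h
  · have h' : 0 < (conj z).im := by simpa using h
    filter_upwards [eventually_gt_atTop 1, eventually_mem_ball_pickRadius h'] with R hR hb
    have hr' : (pickRadius R : ℂ) ≠ 0 := by exact_mod_cast (pickRadius_pos hR).ne'
    have : pickVec R z = fun θ =>
      conj (I * (pickPoint R θ - R * I) / (pickRadius R * (pickPoint R θ - conj z))) := by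
      ext θ; rw [pickVec, if_neg h.not_gt]
    rw [this]
    refine Complex.continuous_conj.comp (Continuous.div ?_ ?_ fun θ =>
      mul_ne_zero hr' (circleMap_sub_ne_zero hb θ))
    · have := hp R; fun_prop
    · have := hp R; fun_prop
  · filter_upwards [eventually_mem_ball_pickRadius h] with R hb
    have : pickVec R z = fun θ => 1 / (pickPoint R θ - z) := by
      ext θ; rw [pickVec, if_pos h]
    rw [this]
    refine continuous_const.div ?_ (circleMap_sub_ne_zero hb)
    have := hp R; fun_prop

/-- The double sum is the integral of `2 Im m * |∑ a i * pickVec R (z i)|²` times a positive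
constant. -/
lemma sum_pickKernel_re_nonneg {m : ℂ → ℂ} (hm : IsNevanlinna m) {R : ℝ} (hR : 1 < R)
    {ι : Type*} (s : Finset ι) (z : ι → ℂ) (a : ι → ℂ)
    (hc : ∀ i ∈ s, Continuous (pickVec R (z i))) :
    0 ≤ (∑ i ∈ s, ∑ j ∈ s, a i * conj (a j) * pickKernel m R (z i) (z j)).re := by
  have hmc : Continuous fun θ => m (pickPoint R θ) :=
    (hm.diffContOnCl_ball hR).continuous_comp_circleMap (pickRadius_pos hR)
  have hint : ∀ i ∈ s, ∀ j ∈ s, IntervalIntegrable (fun θ => a i * conj (a j) *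
      (((2 * (m (pickPoint R θ)).im : ℝ) : ℂ) *
        (pickVec R (z i) θ * conj (pickVec R (z j) θ)))) volume 0 (2 * Real.pi) := by
    intro i hi j hj
    refine Continuous.intervalIntegrable ?_ _ _
    have h1 := hc i hi
    have h2 := Complex.continuous_conj.comp (hc j hj)
    have h3 : Continuous fun θ => ((2 * (m (pickPoint R θ)).im : ℝ) : ℂ) :=
      continuous_ofReal.comp (continuous_const.mul (continuous_im.comp hmc))
    exact continuous_const.mul (h3.mul (h1.mul h2))
  have e : (∑ i ∈ s, ∑ j ∈ s, a i * conj (a j) * pickKernel m R (z i) (z j)) =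
      ((R / (2 * Real.pi) * ∫ θ in 0..2 * Real.pi,
        2 * (m (pickPoint R θ)).im * normSq (∑ i ∈ s, a i * pickVec R (z i) θ) : ℝ) : ℂ) := by
    rw [ofReal_mul, ← intervalIntegral.integral_ofReal]
    have : ∀ θ, ((2 * (m (pickPoint R θ)).im * normSq (∑ i ∈ s, a i * pickVec R (z i) θ) : ℝ) : ℂ) =
        ∑ i ∈ s, ∑ j ∈ s, a i * conj (a j) * (((2 * (m (pickPoint R θ)).im : ℝ) : ℂ) *
        (pickVec R (z i) θ * conj (pickVec R (z j) θ))) := by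
      intro θ
      rw [ofReal_mul, ← mul_conj, map_sum, Finset.sum_mul_sum, Finset.mul_sum]
      refine Finset.sum_congr rfl fun i _ => ?_
      rw [Finset.mul_sum]
      refine Finset.sum_congr rfl fun j _ => ?_
      rw [map_mul]; ring
    simp_rw [this]
    rw [intervalIntegral.integral_finsetSum, Finset.mul_sum]
    · refine Finset.sum_congr rfl fun i hi => ?_
      rw [intervalIntegral.integral_finsetSum, Finset.mul_sum]
      · refine Finset.sum_congr rfl fun j hj => ?_
        rw [intervalIntegral.integral_const_mul, pickKernel]
        push_cast
        ring
      · exact hint i hi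
    · intro i hi
      simpa only [Finset.sum_fn] using IntervalIntegrable.sum _ (hint i hi)
  rw [e, ofReal_re]
  refine mul_nonneg (by positivity) (intervalIntegral.integral_nonneg (by positivity) fun θ _ => ?_)
  exact mul_nonneg (mul_nonneg zero_le_two (hm.im_nonneg _ (pickPoint_im_pos hR θ))) (normSq_nonneg _)

lemma IsNevanlinna.sum_kernelFun_re_nonneg {m : ℂ → ℂ} (hm : IsNevanlinna m)
    {ι : Type*} (s : Finset ι) (z : ι → ℂ) (a : ι → ℂ) (hz : ∀ i ∈ s, (z i).im ≠ 0) :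
    0 ≤ (∑ i ∈ s, ∑ j ∈ s, a i * conj (a j) * nevanlinnaKernelFun m (z i) (z j)).re := by
  have hlim : Tendsto (fun R : ℝ =>
      (∑ i ∈ s, ∑ j ∈ s, a i * conj (a j) * pickKernel m R (z i) (z j)).re) atTop
      (𝓝 (∑ i ∈ s, ∑ j ∈ s, a i * conj (a j) * nevanlinnaKernelFun m (z i) (z j)).re) := by
    refine (continuous_re.tendsto _).comp ?_
    exact tendsto_finsetSum _ fun i hi => tendsto_finsetSum _ fun j hj =>
      (tendsto_pickKernel hm (hz i hi) (hz j hj)).const_mul _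
  have hev : ∀ᶠ R : ℝ in atTop, ∀ i ∈ s, Continuous (pickVec R (z i)) :=
    (Filter.eventually_all_finset s).2 fun i hi => eventually_continuous_pickVec (hz i hi)
  refine ge_of_tendsto hlim ?_
  filter_upwards [hev, eventually_gt_atTop 1] with R hR hR1
  exact sum_pickKernel_re_nonneg hm hR1 s z a hR

lemma nevanlinnaKernel_apply (m : ℂ → ℂ) (z w : NonrealPlane) (v : ℂ) :
    nevanlinnaKernel m z w v = nevanlinnaKernelFun m z w * v := by
  simp [nevanlinnaKernel]

/-- The kernel `K_m` of a Nevanlinna function is nonnegative. -/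
theorem IsNevanlinna.posSemidef_kernel {m : ℂ → ℂ} (hm : IsNevanlinna m) :
    (nevanlinnaKernel m).PosSemidef := by
  have htfae := (RKHS.posSemidef_tfae (K := nevanlinnaKernel m)).out 0 2
  refine htfae.2 ⟨?_, fun v => ?_⟩
  · ext z w : 2
    rw [Matrix.conjTranspose_apply]
    simp only [nevanlinnaKernel, Matrix.of_apply, star_smul, RCLike.star_def]
    rw [hm.kernelFun_conj_symm z.2]
    rw [show star (ContinuousLinearMap.id ℂ ℂ) = ContinuousLinearMap.id ℂ ℂ from star_one _]
  · have h := hm.sum_kernelFun_re_nonneg v.support (fun z => z) (fun z => conj (v z)) fun z _ => z.2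
    rw [← conj_re] at h
    convert h using 2
    simp only [Finsupp.sum, map_sum, Complex.re_sum]
    rw [Finset.sum_comm]
    refine Finset.sum_congr rfl fun z _ => Finset.sum_congr rfl fun w _ => ?_
    rw [nevanlinnaKernel_apply, RCLike.inner_apply]
    change Complex.re _ = _
    congr 1
    simp only [map_mul, conj_conj]
    ring

end

/-! ### Schur's test and analysis operators -/

noncomputable section

open scoped ENNReal NNReal InnerProductSpace

lemma ENNReal.mul_le_half_sq_mul_add (a b t : ℝ≥0∞) (ht : t ≠ 0) (ht' : t ≠ ∞) :
    2 * (a * b) ≤ a ^ 2 * t + b ^ 2 * t⁻¹ := by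
  rcases eq_or_ne a ∞ with rfl | ha
  · simp [ENNReal.top_mul ht]
  rcases eq_or_ne b ∞ with rfl | hb
  · simp [ENNReal.top_mul (ENNReal.inv_ne_zero.2 ht')]
  lift a to ℝ≥0 using ha
  lift b to ℝ≥0 using hb
  lift t to ℝ≥0 using ht'
  have ht0 : t ≠ 0 := by simpa using ht
  rw [← ENNReal.coe_inv ht0]
  norm_cast
  rw [← NNReal.coe_le_coe]
  push_cast
  have ht1 : (0 : ℝ) < t := by positivity
  have h : (0 : ℝ) ≤ (a * t - b) ^ 2 * (t : ℝ)⁻¹ := by positivity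
  have e : ((a : ℝ) * t - b) ^ 2 * (t : ℝ)⁻¹ = a ^ 2 * t + b ^ 2 * (t : ℝ)⁻¹ - 2 * (a * b) := by
    field_simp
    ring
  linarith

/-- Schur's test for a symmetric kernel, as a bound for the quadratic form. -/
theorem lintegral_lintegral_le_of_schur {X : Type*} [MeasurableSpace X] {μ : Measure X} [SFinite μ]
    {M : X → X → ℝ≥0∞} (hM : Measurable (Function.uncurry M)) (hsymm : ∀ x y, M x y = M y x)
    {q : X → ℝ≥0∞} (hq : Measurable q) (hq0 : ∀ x, q x ≠ 0) (hq1 : ∀ x, q x ≠ ∞) {A : ℝ≥0∞}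
    (hA : ∀ᵐ x ∂μ, ∫⁻ y, M x y * q y ∂μ ≤ A * q x) {g : X → ℝ≥0∞} (hg : AEMeasurable g μ) :
    ∫⁻ x, ∫⁻ y, g x * g y * M x y ∂μ ∂μ ≤ A * ∫⁻ x, g x ^ 2 ∂μ := by
  wlog hgm : Measurable g generalizing g
  · obtain ⟨g', hg', hgg'⟩ := hg
    have h := this hg'.aemeasurable hg'
    rw [show ∫⁻ x, g x ^ 2 ∂μ = ∫⁻ x, g' x ^ 2 ∂μ from
      lintegral_congr_ae (hgg'.fun_comp (· ^ 2))]
    convert h using 1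
    refine lintegral_congr_ae ?_
    filter_upwards [hgg'] with x hx
    refine lintegral_congr_ae ?_
    filter_upwards [hgg'] with y hy
    rw [hx, hy]
  have hMx : ∀ x, Measurable (M x) := fun x => hM.comp measurable_prodMk_left
  have hMq : ∀ x, Measurable fun y => M x y * q y := fun x => (hMx x).mul hq
  -- Weighted AM-GM with `t = q y / q x`. Integrating the first term over `y` invokes the Schur
  -- bound; the second becomes the first after exchanging variables.
  have hpt : ∀ x y, 2 * (g x * g y * M x y) ≤
      g x ^ 2 * (q x)⁻¹ * (M x y * q y) + g y ^ 2 * (q y)⁻¹ * (M x y * q x) := by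
    intro x y
    have h := ENNReal.mul_le_half_sq_mul_add (g x) (g y) (q y * (q x)⁻¹)
      (mul_ne_zero (hq0 y) (ENNReal.inv_ne_zero.2 (hq1 x)))
      (ENNReal.mul_ne_top (hq1 y) (ENNReal.inv_ne_top.2 (hq0 x)))
    rw [ENNReal.mul_inv (Or.inl (hq0 y)) (Or.inl (hq1 y)), inv_inv] at h
    calc 2 * (g x * g y * M x y) = 2 * (g x * g y) * M x y := by ring
      _ ≤ (g x ^ 2 * (q y * (q x)⁻¹) + g y ^ 2 * ((q y)⁻¹ * q x)) * M x y := by gcongr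
      _ = _ := by ring
  have hone : ∫⁻ x, ∫⁻ y, g x ^ 2 * (q x)⁻¹ * (M x y * q y) ∂μ ∂μ ≤ A * ∫⁻ x, g x ^ 2 ∂μ := by
    rw [← lintegral_const_mul _ (hgm.pow_const 2)]
    refine lintegral_mono_ae ?_
    filter_upwards [hA] with x hx
    rw [lintegral_const_mul _ (hMq x)]
    calc g x ^ 2 * (q x)⁻¹ * ∫⁻ y, M x y * q y ∂μ ≤ g x ^ 2 * (q x)⁻¹ * (A * q x) := by gcongr
      _ = A * g x ^ 2 * ((q x)⁻¹ * q x) := by ring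
      _ = A * g x ^ 2 := by rw [ENNReal.inv_mul_cancel (hq0 x) (hq1 x), mul_one]
  have htwo : ∫⁻ x, ∫⁻ y, g y ^ 2 * (q y)⁻¹ * (M x y * q x) ∂μ ∂μ ≤ A * ∫⁻ x, g x ^ 2 ∂μ := by
    rw [lintegral_lintegral_swap]
    · simpa only [hsymm] using hone
    · have : Measurable fun p : X × X => g p.2 ^ 2 * (q p.2)⁻¹ * (M p.1 p.2 * q p.1) :=
        (((hgm.comp measurable_snd).pow_const 2).mul (hq.comp measurable_snd).inv).mul
          (hM.mul (hq.comp measurable_fst))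
      exact this.aemeasurable
  have hsum : 2 * ∫⁻ x, ∫⁻ y, g x * g y * M x y ∂μ ∂μ ≤ 2 * (A * ∫⁻ x, g x ^ 2 ∂μ) := by
    have hin : ∀ x, Measurable fun y => g x * g y * M x y := fun x =>
      (hgm.const_mul _).mul (hMx x)
    have hjm : Measurable fun p : X × X => g p.1 * g p.2 * M p.1 p.2 :=
      ((hgm.comp measurable_fst).mul (hgm.comp measurable_snd)).mul hM
    have hjm' : Measurable fun p : X × X => g p.1 ^ 2 * (q p.1)⁻¹ * (M p.1 p.2 * q p.2) :=
        (((hgm.comp measurable_fst).pow_const 2).mul (hq.comp measurable_fst).inv).mul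
          (hM.mul (hq.comp measurable_snd))
    rw [← lintegral_const_mul _ hjm.lintegral_prod_right']
    calc _ = ∫⁻ x, ∫⁻ y, 2 * (g x * g y * M x y) ∂μ ∂μ := by
          refine lintegral_congr fun x => ?_
          rw [lintegral_const_mul _ (hin x)]
      _ ≤ ∫⁻ x, ∫⁻ y, (g x ^ 2 * (q x)⁻¹ * (M x y * q y) +
            g y ^ 2 * (q y)⁻¹ * (M x y * q x)) ∂μ ∂μ :=
          lintegral_mono fun x => lintegral_mono fun y => hpt x y
      _ = ∫⁻ x, ∫⁻ y, g x ^ 2 * (q x)⁻¹ * (M x y * q y) ∂μ ∂μ +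
            ∫⁻ x, ∫⁻ y, g y ^ 2 * (q y)⁻¹ * (M x y * q x) ∂μ ∂μ := by
          rw [← lintegral_add_left hjm'.lintegral_prod_right']
          refine lintegral_congr fun x => ?_
          rw [lintegral_add_left ((hMq x).const_mul _)]
      _ ≤ _ := by rw [two_mul]; gcongr
  rwa [ENNReal.mul_le_mul_iff_right (by simp) (by simp)] at hsum

variable {X : Type*} [MeasurableSpace X] {E : Type*} [NormedAddCommGroup E]
  [InnerProductSpace ℂ E] [CompleteSpace E]

/-- The bound for analysis operators `h ↦ (x ↦ ⟪k x, h⟫)` whose Gram kernel passes Schur's test,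
for bounded `k` and a finite measure. -/
theorem lintegral_enorm_inner_sq_le_of_bounded {μ : Measure X} [IsFiniteMeasure μ] {k : X → E}
    (hk : AEStronglyMeasurable k μ) {B : ℝ} (hB : ∀ᵐ x ∂μ, ‖k x‖ ≤ B)
    {M : X → X → ℝ≥0∞} (hM : Measurable (Function.uncurry M)) (hsymm : ∀ x y, M x y = M y x)
    (hkM : ∀ᵐ x ∂μ, ∀ᵐ y ∂μ, ‖⟪k x, k y⟫_ℂ‖ₑ ≤ M x y)
    {q : X → ℝ≥0∞} (hq : Measurable q) (hq0 : ∀ x, q x ≠ 0) (hq1 : ∀ x, q x ≠ ∞) {A : ℝ≥0}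
    (hA : ∀ᵐ x ∂μ, ∫⁻ y, M x y * q y ∂μ ≤ A * q x) (h : E) :
    ∫⁻ x, ‖⟪k x, h⟫_ℂ‖ₑ ^ 2 ∂μ ≤ A * ‖h‖ₑ ^ 2 := by
  set u : X → ℂ := fun x => ⟪k x, h⟫_ℂ with hu
  have hum : AEStronglyMeasurable u μ := hk.inner aestronglyMeasurable_const
  have hub : ∀ᵐ x ∂μ, ‖u x‖ ≤ B * ‖h‖ := by
    filter_upwards [hB] with x hx
    exact (norm_inner_le_norm _ _).trans (by gcongr)
  have huk : Integrable (fun x => u x • k x) μ := by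
    refine Integrable.of_bound (hum.smul hk) (B * ‖h‖ * B) ?_
    filter_upwards [hB, hub] with x hx hx'
    rw [norm_smul]
    exact mul_le_mul hx' hx (norm_nonneg _) ((norm_nonneg _).trans hx')
  -- With `u = G h` this is `v = G* G h`, and `N = ‖u‖²`. Then `N = ⟪h, v⟫ ≤ ‖h‖ ‖v‖`, while Schur's
  -- test gives `‖v‖² ≤ A N`. So `N² ≤ A ‖h‖² N`, where `N` may be cancelled because it is finite.
  set v : E := ∫ x, u x • k x ∂μ with hv
  set N : ℝ := ∫ x, ‖u x‖ ^ 2 ∂μ with hN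
  have hN0 : 0 ≤ N := integral_nonneg fun x => by positivity
  have hNl : ∫⁻ x, ‖u x‖ₑ ^ 2 ∂μ = ENNReal.ofReal N := by
    rw [hN, ofReal_integral_eq_lintegral_ofReal]
    · refine lintegral_congr fun x => ?_
      rw [ENNReal.ofReal_pow (norm_nonneg _), ofReal_norm]
    · refine Integrable.of_bound (hum.norm.pow 2) ((B * ‖h‖) ^ 2) ?_
      filter_upwards [hub] with x hx
      rw [Real.norm_of_nonneg (by positivity)]
      gcongr
    · exact Eventually.of_forall fun x => by positivity
  have hvh : ⟪h, v⟫_ℂ = N := by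
    rw [hv, ← integral_inner huk, hN, ← integral_complex_ofReal]
    refine integral_congr_ae (Eventually.of_forall fun x => ?_)
    simp only
    rw [inner_smul_right, ← inner_conj_symm h (k x), RCLike.mul_conj]
    norm_cast
  have hle1 : N ≤ ‖h‖ * ‖v‖ := by
    have := norm_inner_le_norm (𝕜 := ℂ) h v
    rwa [hvh, Complex.norm_real, Real.norm_of_nonneg hN0] at this
  have hvv : ‖v‖ₑ ^ 2 ≤ A * ENNReal.ofReal N := by
    have e1 : ⟪v, v⟫_ℂ = ∫ x, ⟪v, u x • k x⟫_ℂ ∂μ := by rw [integral_inner huk]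
    have e2 : ‖⟪v, v⟫_ℂ‖ₑ = ‖v‖ₑ ^ 2 := by
      rw [← ofReal_norm, ← ofReal_norm, ← ENNReal.ofReal_pow (norm_nonneg _),
        inner_self_eq_norm_sq_to_K]
      simp
    rw [← e2, e1, ← hNl]
    refine (enorm_integral_le_lintegral_enorm _).trans ((lintegral_mono_ae ?_).trans
      (lintegral_lintegral_le_of_schur hM hsymm hq hq0 hq1 hA hum.enorm))
    filter_upwards [hkM] with x hx
    rw [inner_smul_right, enorm_mul]
    have : ‖⟪v, k x⟫_ℂ‖ₑ ≤ ∫⁻ y, ‖u y‖ₑ * M x y ∂μ := by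
      rw [← inner_conj_symm, RCLike.enorm_conj, hv, ← integral_inner huk]
      refine (enorm_integral_le_lintegral_enorm _).trans (lintegral_mono_ae ?_)
      filter_upwards [hx] with y hy
      rw [inner_smul_right, enorm_mul]
      gcongr
    refine (mul_le_mul_right this _).trans_eq ?_
    have hux : AEMeasurable (fun y => ‖u y‖ₑ * M x y) μ :=
      hum.enorm.mul (hM.comp measurable_prodMk_left).aemeasurable
    rw [← lintegral_const_mul'' _ hux]
    simp only [mul_assoc]
  have hvv' : ‖v‖ ^ 2 ≤ A * N := by
    rw [← ofReal_norm, ← ENNReal.ofReal_pow (norm_nonneg _), ← ENNReal.ofReal_coe_nnreal,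
      ← ENNReal.ofReal_mul A.coe_nonneg] at hvv
    exact (ENNReal.ofReal_le_ofReal_iff (mul_nonneg A.coe_nonneg hN0)).1 hvv
  have hfin : N ≤ A * ‖h‖ ^ 2 := by
    rcases hN0.eq_or_lt with h0 | h0
    · rw [← h0]; positivity
    · have : N * N ≤ (A * ‖h‖ ^ 2) * N := by
        calc N * N ≤ (‖h‖ * ‖v‖) * (‖h‖ * ‖v‖) := by gcongr
          _ = ‖h‖ ^ 2 * ‖v‖ ^ 2 := by ring
          _ ≤ ‖h‖ ^ 2 * (A * N) := by gcongr
          _ = _ := by ring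
      exact le_of_mul_le_mul_right this h0
  rw [hNl, ← ofReal_norm, ← ENNReal.ofReal_pow (norm_nonneg _), ← ENNReal.ofReal_coe_nnreal,
      ← ENNReal.ofReal_mul A.coe_nonneg]
  exact ENNReal.ofReal_le_ofReal hfin

/-- Analysis operators `h ↦ (x ↦ ⟪k x, h⟫)` whose Gram kernel passes Schur's test are bounded
into `L²`. -/
theorem exists_continuousLinearMap_of_schur {μ : Measure X} {k : X → E}
    (hk : AEStronglyMeasurable k μ) {S : ℕ → Set X} (hSm : ∀ n, MeasurableSet (S n))
    (hmono : Monotone S) (hSfin : ∀ n, μ (S n) < ∞) (hS : ∀ᵐ x ∂μ, ∃ n, x ∈ S n)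
    (hbdd : ∀ n, ∃ B : ℝ, ∀ x ∈ S n, ‖k x‖ ≤ B)
    {M : X → X → ℝ≥0∞} (hM : Measurable (Function.uncurry M)) (hsymm : ∀ x y, M x y = M y x)
    (hkM : ∀ᵐ x ∂μ, ∀ᵐ y ∂μ, ‖⟪k x, k y⟫_ℂ‖ₑ ≤ M x y)
    {q : X → ℝ≥0∞} (hq : Measurable q) (hq0 : ∀ x, q x ≠ 0) (hq1 : ∀ x, q x ≠ ∞) {A : ℝ≥0}
    (hA : ∀ᵐ x ∂μ, ∫⁻ y, M x y * q y ∂μ ≤ A * q x) :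
    ∃ G : E →L[ℂ] Lp ℂ 2 μ, ∀ h, ∀ᵐ x ∂μ, G h x = ⟪k x, h⟫_ℂ := by
  have hbound : ∀ h, ∫⁻ x, ‖⟪k x, h⟫_ℂ‖ₑ ^ 2 ∂μ ≤ A * ‖h‖ₑ ^ 2 := by
    intro h
    -- The bound on each `S n` has the same constant `A`, since Schur's condition survives
    -- restriction; it passes to the increasing union.
    have hu : μ.restrict (⋃ n, S n) = μ := by
      refine Measure.restrict_eq_self_of_ae_mem ?_
      filter_upwards [hS] with x hx
      exact Set.mem_iUnion.2 hx
    rw [← hu, setLIntegral_iUnion_of_directed _ (hmono.directed_le)]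
    refine iSup_le fun n => ?_
    obtain ⟨B, hB⟩ := hbdd n
    have : IsFiniteMeasure (μ.restrict (S n)) := ⟨by simpa using hSfin n⟩
    refine lintegral_enorm_inner_sq_le_of_bounded hk.restrict (B := B)
      ((ae_restrict_iff' (hSm n)).2 (Eventually.of_forall hB)) hM hsymm ?_ hq hq0 hq1 ?_ h
    · refine ae_restrict_of_ae ?_
      filter_upwards [hkM] with x hx
      exact ae_restrict_of_ae hx
    · refine ae_restrict_of_ae ?_
      filter_upwards [hA] with x hx
      exact (setLIntegral_le_lintegral _ _).trans hx
  have hnorm : ∀ h, eLpNorm (fun x => ⟪k x, h⟫_ℂ) 2 μ ≤ ENNReal.ofReal (√A * ‖h‖) := by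
    intro h
    rw [eLpNorm_eq_lintegral_rpow_enorm_toReal (by simp) (by simp)]
    simp only [ENNReal.toReal_ofNat, ENNReal.rpow_ofNat]
    refine (ENNReal.rpow_le_rpow (hbound h) (by simp)).trans_eq ?_
    rw [← ofReal_norm, ← ENNReal.ofReal_pow (norm_nonneg _), ← ENNReal.ofReal_coe_nnreal,
      ← ENNReal.ofReal_mul A.coe_nonneg, ENNReal.ofReal_rpow_of_nonneg (by positivity) (by simp),
      ← Real.sqrt_eq_rpow, Real.sqrt_mul A.coe_nonneg, Real.sqrt_sq (norm_nonneg _)]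
  have hmem : ∀ h, MemLp (fun x => ⟪k x, h⟫_ℂ) 2 μ := fun h =>
    ⟨hk.inner aestronglyMeasurable_const, (hnorm h).trans_lt ENNReal.ofReal_lt_top⟩
  refine ⟨LinearMap.mkContinuous
    { toFun := fun h => (hmem h).toLp _
      map_add' := fun h₁ h₂ => ?_
      map_smul' := fun c h => ?_ } (√A) fun h => ?_, fun h => ?_⟩
  · rw [← MemLp.toLp_add]
    exact MemLp.toLp_congr _ _ (Eventually.of_forall fun x => inner_add_right _ _ _)
  · rw [RingHom.id_apply, ← MemLp.toLp_const_smul]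
    exact MemLp.toLp_congr _ _ (Eventually.of_forall fun x => inner_smul_right _ _ _)
  · simp only [LinearMap.coe_mk, AddHom.coe_mk, Lp.norm_toLp]
    exact ENNReal.toReal_le_of_le_ofReal (by positivity) (hnorm h)
  · exact (hmem h).coeFn_toLp

end

/-! ### Schur's test for the power kernel -/

noncomputable section

open scoped ENNReal NNReal InnerProductSpace

lemma setLIntegral_Ioc_rpow_neg {γ y : ℝ} (hγ1 : γ < 1) (hy : 0 < y) :
    ∫⁻ s in Set.Ioc 0 y, ENNReal.ofReal (s ^ (-γ)) = ENNReal.ofReal (y ^ (1 - γ) / (1 - γ)) := by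
  have hi : IntegrableOn (fun s : ℝ => s ^ (-γ)) (Set.Ioc 0 y) :=
    (intervalIntegrable_iff_integrableOn_Ioc_of_le hy.le).1
      (intervalIntegral.intervalIntegrable_rpow' (by linarith))
  rw [← ofReal_integral_eq_lintegral_ofReal hi]
  · rw [← intervalIntegral.integral_of_le hy.le, integral_rpow (Or.inl (by linarith)),
      Real.zero_rpow (by linarith), sub_zero, neg_add_eq_sub]
  · refine (ae_restrict_iff' measurableSet_Ioc).2 (Eventually.of_forall fun s hs => ?_)
    exact Real.rpow_nonneg hs.1.le _

lemma setLIntegral_Ioi_rpow_neg {γ y : ℝ} (hγ0 : 0 < γ) (hy : 0 < y) :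
    ∫⁻ s in Set.Ioi y, ENNReal.ofReal (s ^ (-γ - 1)) = ENNReal.ofReal (y ^ (-γ) / γ) := by
  have hi : IntegrableOn (fun s : ℝ => s ^ (-γ - 1)) (Set.Ioi y) :=
    integrableOn_Ioi_rpow_of_lt (by linarith) hy
  rw [← ofReal_integral_eq_lintegral_ofReal hi]
  · rw [integral_Ioi_rpow_of_lt (by linarith) hy, sub_add_cancel, neg_div_neg_eq]
  · refine (ae_restrict_iff' measurableSet_Ioi).2 (Eventually.of_forall fun s hs => ?_)
    exact Real.rpow_nonneg (hy.trans hs).le _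

/-- Split at `s = y`, with `1 / (y + s) ≤ 1 / y` below and `1 / (y + s) ≤ 1 / s` above. -/
lemma setLIntegral_Ioi_rpow_neg_div_add_le {γ y : ℝ} (hγ0 : 0 < γ) (hγ1 : γ < 1) (hy : 0 < y) :
    ∫⁻ s in Set.Ioi 0, ENNReal.ofReal (s ^ (-γ) / (y + s)) ≤
      ENNReal.ofReal ((1 / (1 - γ) + 1 / γ) * y ^ (-γ)) := by
  rw [← Set.Ioc_union_Ioi_eq_Ioi hy.le]
  refine (lintegral_union_le _ _ _).trans ?_
  have h1 : 0 < 1 - γ := by linarith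
  rw [add_mul, ENNReal.ofReal_add (by positivity) (by positivity)]
  gcongr
  · calc _ ≤ ∫⁻ s in Set.Ioc 0 y, ENNReal.ofReal (1 / y) * ENNReal.ofReal (s ^ (-γ)) := by
          refine setLIntegral_mono' measurableSet_Ioc fun s hs => ?_
          have hs0 := hs.1
          rw [← ENNReal.ofReal_mul (by positivity), div_eq_mul_one_div, mul_comm]
          gcongr
          linarith
      _ = _ := by
          rw [lintegral_const_mul' _ _ ENNReal.ofReal_ne_top, setLIntegral_Ioc_rpow_neg hγ1 hy,
            ← ENNReal.ofReal_mul (by positivity), sub_eq_add_neg, Real.rpow_add hy, Real.rpow_one]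
          congr 1
          field_simp
  · calc _ ≤ ∫⁻ s in Set.Ioi y, ENNReal.ofReal (s ^ (-γ - 1)) := by
          refine setLIntegral_mono' measurableSet_Ioi fun s hs => ?_
          have hs0 : 0 < s := hy.trans hs
          rw [Real.rpow_sub_one hs0.ne']
          gcongr
          linarith
      _ = _ := by
          rw [setLIntegral_Ioi_rpow_neg hγ0 hy]
          congr 1
          ring

lemma ContinuousOn.aemeasurable_weight {m : ℂ → ℂ} (hw : ContinuousOn (weight m) (Set.Ici 1)) :
    AEMeasurable (fun y => ENNReal.ofReal (weight m y)) (volume.restrict (Set.Ioi 1)) :=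
  ((hw.mono Set.Ioi_subset_Ici_self).aemeasurable measurableSet_Ioi).ennreal_ofReal

lemma ae_weightMeasure_one_lt (m : ℂ → ℂ) : ∀ᵐ y ∂(weightMeasure m), 1 < y :=
  (withDensity_absolutelyContinuous _ _).ae_le (ae_restrict_mem measurableSet_Ioi)

/-- Schur's test for the kernel `(y ^ (-α) + s ^ (-α)) / (y + s)` and a weight `O(s ^ α)`. -/
lemma lintegral_weightMeasure_rpow_add_rpow_le {m : ℂ → ℂ} {α W B : ℝ} (hα₀ : 0 < α)
    (hα₁ : α < 1) (hw : ContinuousOn (weight m) (Set.Ici 1)) (hW : 0 ≤ W) (hB : 0 ≤ B)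
    (hwle : ∀ y, 1 ≤ y → weight m y ≤ W * y ^ α) :
    ∃ A : ℝ≥0, ∀ y, 1 < y → ∫⁻ s, ENNReal.ofReal
      (B * ((y ^ (-α) + (max s 1) ^ (-α)) / (y + max s 1))) *
        ENNReal.ofReal ((max s 1) ^ (-((1 + α) / 2))) ∂(weightMeasure m) ≤
      A * ENNReal.ofReal (y ^ (-((1 + α) / 2))) := by
  -- Multiplied by the weight, the two terms of the kernel produce the exponents `-(β - α)` and
  -- `-β`. Both integrals converge when `α < β < 1`, and `β` is the midpoint of that range.
  set β := (1 + α) / 2 with hβ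
  have hβ0 : 0 < β := by linarith
  have hβ1 : β < 1 := by linarith
  have hγ0 : 0 < β - α := by linarith
  have hγ1 : β - α < 1 := by linarith
  have hβ1' : 0 < 1 - β := by linarith
  have hγ1' : 0 < 1 - (β - α) := by linarith
  refine ⟨(W * B * ((1 / (1 - (β - α)) + 1 / (β - α)) + (1 / (1 - β) + 1 / β))).toNNReal,
    fun y hy => ?_⟩
  have hy0 : 0 < y := by linarith
  have hmeas : Measurable fun s : ℝ => ENNReal.ofReal
      (B * ((y ^ (-α) + (max s 1) ^ (-α)) / (y + max s 1))) *
        ENNReal.ofReal ((max s 1) ^ (-β)) := by fun_prop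
  rw [weightMeasure, lintegral_withDensity_eq_lintegral_mul₀ hw.aemeasurable_weight
    hmeas.aemeasurable]
  calc _ ≤ ∫⁻ s in Set.Ioi 1, (ENNReal.ofReal (W * B * y ^ (-α)) *
        ENNReal.ofReal (s ^ (-(β - α)) / (y + s)) +
        ENNReal.ofReal (W * B) * ENNReal.ofReal (s ^ (-β) / (y + s))) := by
        refine setLIntegral_mono' measurableSet_Ioi fun s hs => ?_
        have hs1 : (1 : ℝ) < s := hs
        have hs0 : 0 < s := by linarith
        simp only [Pi.mul_apply, max_eq_left hs1.le]
        rw [← ENNReal.ofReal_mul (by positivity), ← ENNReal.ofReal_mul' (by positivity),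
          ← ENNReal.ofReal_mul (by positivity), ← ENNReal.ofReal_mul (by positivity),
          ← ENNReal.ofReal_add (by positivity) (by positivity)]
        refine ENNReal.ofReal_le_ofReal ?_
        calc _ ≤ (W * s ^ α) * (B * ((y ^ (-α) + s ^ (-α)) / (y + s)) * s ^ (-β)) := by
              gcongr
              exact hwle s hs1.le
          _ = _ := by
              have e1 : s ^ (-(β - α)) = s ^ α * s ^ (-β) := by
                rw [← Real.rpow_add hs0]; congr 1; ring
              have e2 : s ^ α * s ^ (-α) = 1 := by
                rw [← Real.rpow_add hs0, add_neg_cancel, Real.rpow_zero]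
              rw [e1]
              linear_combination (W * B * s ^ (-β) / (y + s)) * e2
    _ ≤ ∫⁻ s in Set.Ioi 0, (ENNReal.ofReal (W * B * y ^ (-α)) *
        ENNReal.ofReal (s ^ (-(β - α)) / (y + s)) +
        ENNReal.ofReal (W * B) * ENNReal.ofReal (s ^ (-β) / (y + s))) :=
        lintegral_mono_set (Set.Ioi_subset_Ioi zero_le_one)
    _ = ENNReal.ofReal (W * B * y ^ (-α)) * (∫⁻ s in Set.Ioi 0,
        ENNReal.ofReal (s ^ (-(β - α)) / (y + s))) +
        ENNReal.ofReal (W * B) * ∫⁻ s in Set.Ioi 0, ENNReal.ofReal (s ^ (-β) / (y + s)) := by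
        rw [lintegral_add_left (by fun_prop), lintegral_const_mul' _ _ ENNReal.ofReal_ne_top,
          lintegral_const_mul' _ _ ENNReal.ofReal_ne_top]
    _ ≤ ENNReal.ofReal (W * B * y ^ (-α)) *
          ENNReal.ofReal ((1 / (1 - (β - α)) + 1 / (β - α)) * y ^ (-(β - α))) +
        ENNReal.ofReal (W * B) * ENNReal.ofReal ((1 / (1 - β) + 1 / β) * y ^ (-β)) := by
        gcongr
        · exact setLIntegral_Ioi_rpow_neg_div_add_le hγ0 hγ1 hy0
        · exact setLIntegral_Ioi_rpow_neg_div_add_le hβ0 hβ1 hy0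
    _ = _ := by
        rw [← ENNReal.ofReal_mul (by positivity), ← ENNReal.ofReal_mul (by positivity),
          ← ENNReal.ofReal_add (by positivity) (by positivity), ← ENNReal.ofReal_coe_nnreal,
          Real.coe_toNNReal _ (by positivity), ← ENNReal.ofReal_mul (by positivity)]
        congr 1
        have e1 : y ^ (-β) = y ^ (-α) * y ^ (-(β - α)) := by
          rw [← Real.rpow_add hy0]; congr 1; ring
        rw [e1]
        ring

/-- A continuous family of vectors whose Gram kernel is `O((y ^ (-α) + s ^ (-α)) / (y + s))`
induces a bounded operator into `L²` with a weight `O(y ^ α)`. -/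
theorem exists_continuousLinearMap_weightMeasure {m : ℂ → ℂ} {α W B : ℝ} (hα₀ : 0 < α)
    (hα₁ : α < 1) (hw : ContinuousOn (weight m) (Set.Ici 1)) (hW : 0 ≤ W) (hB : 0 ≤ B)
    (hwle : ∀ y, 1 ≤ y → weight m y ≤ W * y ^ α)
    {E : Type*} [NormedAddCommGroup E] [InnerProductSpace ℂ E] [CompleteSpace E]
    {k : ℝ → E} (hk : Continuous k)
    (hkB : ∀ y s, 1 < y → 1 < s →
      ‖⟪k y, k s⟫_ℂ‖ ≤ B * ((y ^ (-α) + s ^ (-α)) / (y + s))) :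
    ∃ G : E →L[ℂ] Lp ℂ 2 (weightMeasure m), ∀ h, ∀ᵐ y ∂(weightMeasure m), G h y = ⟪k y, h⟫_ℂ := by
  obtain ⟨A, hA⟩ := lintegral_weightMeasure_rpow_add_rpow_le hα₀ hα₁ hw hW hB hwle
  -- The measure lives on `(1, ∞)`; writing `max y 1` for `y` makes the kernel symmetric and `q`
  -- positive and finite on all of `ℝ`.
  refine exists_continuousLinearMap_of_schur (S := fun n : ℕ => Set.Icc 1 (n : ℝ))
    (M := fun y s => ENNReal.ofReal
      (B * (((max y 1) ^ (-α) + (max s 1) ^ (-α)) / (max y 1 + max s 1))))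
    (q := fun s => ENNReal.ofReal ((max s 1) ^ (-((1 + α) / 2)))) (A := A)
    hk.aestronglyMeasurable (fun n => measurableSet_Icc)
    (fun a b hab => Set.Icc_subset_Icc_right (by exact_mod_cast hab)) ?_ ?_ ?_ ?_ ?_ ?_ ?_ ?_ ?_ ?_
  · intro n
    rw [weightMeasure, withDensity_apply _ measurableSet_Icc]
    obtain ⟨D, hD⟩ := (isCompact_Icc (a := (1 : ℝ)) (b := n)).exists_bound_of_continuousOn
      (hw.mono Set.Icc_subset_Ici_self)
    calc _ ≤ ∫⁻ y in Set.Icc 1 (n : ℝ), ENNReal.ofReal (weight m y) :=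
          lintegral_mono' (Measure.restrict_mono_measure Measure.restrict_le_self _) le_rfl
      _ ≤ ∫⁻ y in Set.Icc 1 (n : ℝ), ENNReal.ofReal D :=
          setLIntegral_mono' measurableSet_Icc fun y hy =>
            ENNReal.ofReal_le_ofReal ((le_abs_self _).trans (hD y hy))
      _ < ∞ := by
          rw [setLIntegral_const]
          exact ENNReal.mul_lt_top ENNReal.ofReal_lt_top measure_Icc_lt_top
  · filter_upwards [ae_weightMeasure_one_lt m] with y hy
    obtain ⟨n, hn⟩ := exists_nat_ge y
    exact ⟨n, hy.le, hn⟩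
  · intro n
    exact isCompact_Icc.exists_bound_of_continuousOn hk.continuousOn
  · simp only [Function.uncurry_def]
    fun_prop
  · intro y s
    rw [add_comm (max y 1), add_comm (max y 1 ^ _)]
  · filter_upwards [ae_weightMeasure_one_lt m] with y hy
    filter_upwards [ae_weightMeasure_one_lt m] with s hs
    rw [max_eq_left hy.le, max_eq_left hs.le, ← ofReal_norm]
    exact ENNReal.ofReal_le_ofReal (hkB y s hy hs)
  · fun_prop
  · intro s
    rw [ENNReal.ofReal_ne_zero_iff]
    exact Real.rpow_pos_of_pos (by positivity) _
  · exact fun s => ENNReal.ofReal_ne_top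
  · filter_upwards [ae_weightMeasure_one_lt m] with y hy
    simpa only [max_eq_left hy.le] using hA y hy

end

/-! ### Asymptotics on the imaginary axis and the `B_∞`-property -/

noncomputable section

open scoped ENNReal NNReal InnerProductSpace
open Complex ComplexConjugate

lemma ContinuousOn.exists_norm_le_of_tendsto {F : Type*} [NormedAddCommGroup F] {f : ℝ → F}
    {a : ℝ} {l : F} (hf : ContinuousOn f (Set.Ici a)) (hl : Tendsto f atTop (𝓝 l)) :
    ∃ D : ℝ, 0 ≤ D ∧ ∀ y, a ≤ y → ‖f y‖ ≤ D := by
  obtain ⟨Y, hY⟩ := eventually_atTop.1 (hl.norm.eventually (gt_mem_nhds (lt_add_one ‖l‖)))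
  obtain ⟨D, hD⟩ := (isCompact_Icc (a := a) (b := Y)).exists_bound_of_continuousOn
    (hf.mono Set.Icc_subset_Ici_self)
  refine ⟨max D (‖l‖ + 1), le_max_of_le_right (by positivity), fun y hy => ?_⟩
  rcases le_total y Y with h | h
  · exact (hD y ⟨hy, h⟩).trans (le_max_left _ _)
  · exact (hY y h).le.trans (le_max_right _ _)

/-- The limit of `r ^ α * m (i r)`. -/
lemma tendsto_rpow_mul_apply_I {m : ℂ → ℂ} {α C : ℝ} (hC : 0 < C)
    (hasymp : Tendsto (fun r : ℝ => m (r * I) / ((C : ℂ) / (-((r : ℂ) * I)) ^ (α : ℂ))) atTop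
      (𝓝 1)) :
    Tendsto (fun r : ℝ => ((r ^ α : ℝ) : ℂ) * m (r * I)) atTop
      (𝓝 (C * exp ((Real.pi * α / 2 : ℝ) * I))) := by
  have h := hasymp.mul_const ((C : ℂ) * exp ((Real.pi * α / 2 : ℝ) * I))
  rw [one_mul] at h
  refine h.congr' ?_
  filter_upwards [eventually_gt_atTop 0] with r hr
  have hC' : (C : ℂ) ≠ 0 := by exact_mod_cast hC.ne'
  have hr' : (r : ℂ) ≠ 0 := by exact_mod_cast hr.ne'
  -- The principal argument of `-ir` is `-π/2`.
  have e : (-((r : ℂ) * I)) ^ (α : ℂ) =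
      ((r ^ α : ℝ) : ℂ) * (exp ((Real.pi * α / 2 : ℝ) * I))⁻¹ := by
    rw [← mul_neg, cpow_def_of_ne_zero (mul_ne_zero hr' (neg_ne_zero.2 I_ne_zero)),
      log_ofReal_mul hr (neg_ne_zero.2 I_ne_zero), log_neg_I, add_mul, exp_add, ← exp_neg,
      Real.rpow_def_of_pos hr]
    push_cast
    congr 2
    ring
  have he := exp_ne_zero ((Real.pi * α / 2 : ℝ) * I)
  rw [e]
  field_simp

lemma tendsto_rpow_mul_im {m : ℂ → ℂ} {α C : ℝ} (hC : 0 < C)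
    (hasymp : Tendsto (fun r : ℝ => m (r * I) / ((C : ℂ) / (-((r : ℂ) * I)) ^ (α : ℂ))) atTop
      (𝓝 1)) :
    Tendsto (fun r : ℝ => r ^ α * (m (r * I)).im) atTop
      (𝓝 (C * Real.sin (Real.pi * α / 2))) := by
  have h := (continuous_im.tendsto _).comp (tendsto_rpow_mul_apply_I hC hasymp)
  rw [im_ofReal_mul, exp_ofReal_mul_I_im] at h
  simpa only [Function.comp_def, im_ofReal_mul] using h

lemma sin_pi_mul_half_pos {α : ℝ} (hα₀ : 0 < α) (hα₁ : α < 1) :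
    0 < Real.sin (Real.pi * α / 2) :=
  Real.sin_pos_of_pos_of_lt_pi (by positivity) (by nlinarith [Real.pi_pos])

/-- The point `i y` of the upper half-plane, with `y` replaced by `1` if `y < 1`. -/
def imagPointMax (y : ℝ) : NonrealPlane :=
  ⟨(max y 1 : ℝ) * I, by
    have : max y 1 ≠ 0 := by positivity
    simpa using this⟩

lemma IsNevanlinna.continuousOn_apply_I {m : ℂ → ℂ} (hm : IsNevanlinna m) :
    ContinuousOn (fun y : ℝ => m (y * I)) (Set.Ioi 0) :=
  hm.differentiableOn.continuousOn.comp (by fun_prop) fun y hy => by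
    simpa using (ne_of_gt hy : y ≠ 0)

/-- The Cauchy–Schwarz inequality in `H(m)`. -/
lemma IsNevanlinna.norm_kernelFun_sq_le {m : ℂ → ℂ} (hm : IsNevanlinna m) (z w : NonrealPlane) :
    ‖nevanlinnaKernelFun m z w‖ ^ 2 ≤ ‖nevanlinnaKernelFun m z z‖ * ‖nevanlinnaKernelFun m w w‖ := by
  have : Fact (nevanlinnaKernel m).PosSemidef := ⟨hm.posSemidef_kernel⟩
  have h := RKHS.norm_kernel_sq_le (RKHS.OfKernel (nevanlinnaKernel m)) z w
  rw [RKHS.OfKernel.kernel_ofKernel] at h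
  have e : ∀ x y, ‖nevanlinnaKernel m x y‖ = ‖nevanlinnaKernelFun m x y‖ := fun x y => by
    rw [nevanlinnaKernel, Matrix.of_apply, norm_smul]
    have := ContinuousLinearMap.norm_id (𝕜 := ℂ) (E := ℂ)
    rw [this, mul_one]
  simpa only [e] using h

lemma nevanlinnaKernelFun_I {m : ℂ → ℂ} {y s : ℝ} (hy : 0 < y) (hs : 0 < s) :
    nevanlinnaKernelFun m (y * I) (s * I) =
      (m (y * I) - conj (m (s * I))) / ((y + s : ℝ) * I) := by
  have e : (y : ℂ) * I - conj ((s : ℂ) * I) = (y + s : ℝ) * I := by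
    rw [map_mul, conj_ofReal, conj_I]; push_cast; ring
  have hne : (y : ℂ) * I ≠ conj ((s : ℂ) * I) := by
    rw [← sub_ne_zero, e]
    exact mul_ne_zero (by exact_mod_cast (add_pos hy hs).ne') I_ne_zero
  rw [nevanlinnaKernelFun, if_neg hne, e]

/-- This plays the role of the minimum principle for `Im m`. If `K_m(iy, iy) = 0`, Cauchy–Schwarz
forces `K_m(is, iy) = 0`, so `m (is) = conj (m (iy))` is real. -/
lemma IsNevanlinna.im_apply_I_eq_zero {m : ℂ → ℂ} (hm : IsNevanlinna m) {y s : ℝ} (hy : 0 < y)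
    (hs : 0 < s) (h : (m (y * I)).im = 0) : (m (s * I)).im = 0 := by
  have hyi : ((y : ℂ) * I).im ≠ 0 := by simpa using hy.ne'
  have hsi : ((s : ℂ) * I).im ≠ 0 := by simpa using hs.ne'
  have hle := hm.norm_kernelFun_sq_le ⟨_, hsi⟩ ⟨_, hyi⟩
  have hyy : nevanlinnaKernelFun m (y * I) (y * I) = 0 := by
    rw [nevanlinnaKernelFun_I hy hy, sub_conj, h]
    simp
  rw [hyy, norm_zero, mul_zero] at hle
  have h0 : nevanlinnaKernelFun m (s * I) (y * I) = 0 :=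
    norm_eq_zero.1 (pow_eq_zero_iff two_ne_zero |>.1 (le_antisymm hle (by positivity)))
  rw [nevanlinnaKernelFun_I hs hy, div_eq_zero_iff, or_iff_left
    (mul_ne_zero (by exact_mod_cast (add_pos hs hy).ne') I_ne_zero), sub_eq_zero] at h0
  rw [h0, conj_im, h, neg_zero]

/-- A zero would propagate along the whole half-axis, against the positive limit of `r ^ α * Im m
(ir)`. -/
lemma IsNevanlinna.im_apply_I_pos {m : ℂ → ℂ} (hm : IsNevanlinna m) {α C : ℝ} (hα₀ : 0 < α)
    (hα₁ : α < 1) (hC : 0 < C)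
    (hasymp : Tendsto (fun r : ℝ => m (r * I) / ((C : ℂ) / (-((r : ℂ) * I)) ^ (α : ℂ))) atTop
      (𝓝 1)) {y : ℝ} (hy : 0 < y) : 0 < (m (y * I)).im := by
  refine (hm.im_nonneg _ (by simpa using hy)).lt_of_ne' fun h => ?_
  have hlim := tendsto_rpow_mul_im hC hasymp
  have hpos := mul_pos hC (sin_pi_mul_half_pos hα₀ hα₁)
  obtain ⟨s, hs, hs0⟩ := ((hlim.eventually (lt_mem_nhds hpos)).and (eventually_gt_atTop 0)).exists
  rw [hm.im_apply_I_eq_zero hy hs0 h, mul_zero] at hs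
  exact hs.false

/-- A Nevanlinna function with the given power asymptotics along the imaginary axis is
`O(y ^ (-α))` there. -/
lemma IsNevanlinna.exists_norm_apply_I_le {m : ℂ → ℂ} (hm : IsNevanlinna m) {α C : ℝ}
    (hC : 0 < C)
    (hasymp : Tendsto (fun r : ℝ => m (r * I) / ((C : ℂ) / (-((r : ℂ) * I)) ^ (α : ℂ))) atTop
      (𝓝 1)) :
    ∃ D : ℝ, 0 ≤ D ∧ ∀ y : ℝ, 1 ≤ y → ‖m (y * I)‖ ≤ D * y ^ (-α) := by
  have hsub : Set.Ici (1 : ℝ) ⊆ Set.Ioi 0 := Set.Ici_subset_Ioi.2 one_pos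
  have hpow : ContinuousOn (fun y : ℝ => y ^ α) (Set.Ici 1) := fun y hy =>
    (Real.continuousAt_rpow_const y α (Or.inl (hsub hy).ne')).continuousWithinAt
  obtain ⟨D, hD0, hD⟩ := ContinuousOn.exists_norm_le_of_tendsto
    ((continuous_ofReal.comp_continuousOn hpow).mul (hm.continuousOn_apply_I.mono hsub))
    (tendsto_rpow_mul_apply_I hC hasymp)
  refine ⟨D, hD0, fun y hy => ?_⟩
  have hy0 : 0 < y := hsub hy
  have h : ‖((y ^ α : ℝ) : ℂ) * m (y * I)‖ ≤ D := hD y hy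
  rw [norm_mul, norm_real, Real.norm_of_nonneg (by positivity)] at h
  rw [Real.rpow_neg hy0.le, ← div_eq_mul_inv, le_div_iff₀ (by positivity), mul_comm]
  exact h

lemma IsNevanlinna.continuousOn_weight {m : ℂ → ℂ} (hm : IsNevanlinna m)
    (hpos : ∀ y : ℝ, 0 < y → 0 < (m (y * I)).im) : ContinuousOn (weight m) (Set.Ioi 0) :=
  continuousOn_const.div (continuous_im.comp_continuousOn hm.continuousOn_apply_I)
    fun y hy => (hpos y hy).ne'

/-- The weight of a Nevanlinna function with the given power asymptotics along the imaginary axis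
is `O(y ^ α)`. -/
lemma IsNevanlinna.exists_weight_le {m : ℂ → ℂ} (hm : IsNevanlinna m) {α C : ℝ} (hα₀ : 0 < α)
    (hα₁ : α < 1) (hC : 0 < C)
    (hasymp : Tendsto (fun r : ℝ => m (r * I) / ((C : ℂ) / (-((r : ℂ) * I)) ^ (α : ℂ))) atTop
      (𝓝 1)) :
    ∃ W : ℝ, 0 ≤ W ∧ ∀ y : ℝ, 1 ≤ y → weight m y ≤ W * y ^ α := by
  have hsub : Set.Ici (1 : ℝ) ⊆ Set.Ioi 0 := Set.Ici_subset_Ioi.2 one_pos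
  have hpos := mul_pos hC (sin_pi_mul_half_pos hα₀ hα₁)
  have hpow : ContinuousOn (fun y : ℝ => y ^ α) (Set.Ici 1) := fun y hy =>
    (Real.continuousAt_rpow_const y α (Or.inl (hsub hy).ne')).continuousWithinAt
  have hprod : ContinuousOn (fun y : ℝ => (y ^ α * (m (y * I)).im)⁻¹) (Set.Ici 1) :=
    (hpow.mul (continuous_im.comp_continuousOn (hm.continuousOn_apply_I.mono hsub))).inv₀
      fun y hy => by
        have := hm.im_apply_I_pos hα₀ hα₁ hC hasymp (hsub hy)
        have hy0 : 0 < y := hsub hy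
        exact (mul_pos (Real.rpow_pos_of_pos hy0 α) this).ne'
  -- The reciprocal has a finite limit at infinity because `C sin (πα/2) > 0`.
  obtain ⟨W, hW0, hW⟩ := hprod.exists_norm_le_of_tendsto
    ((tendsto_rpow_mul_im hC hasymp).inv₀ hpos.ne')
  refine ⟨W, hW0, fun y hy => ?_⟩
  have hy0 : 0 < y := hsub hy
  have h := (le_abs_self _).trans (hW y hy)
  rw [mul_inv, inv_mul_le_iff₀ (by positivity)] at h
  rw [weight, one_div, mul_comm W]
  exact h

/-- Expand `‖k s - k t‖²` into four Gram entries, which cancel at `s = t`. -/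
lemma continuous_of_continuous_gram {E T : Type*} [NormedAddCommGroup E] [InnerProductSpace ℂ E]
    [TopologicalSpace T] {k : T → E} (hk : Continuous fun p : T × T => ⟪k p.1, k p.2⟫_ℂ) :
    Continuous k := by
  refine continuous_iff_continuousAt.2 fun t => tendsto_iff_norm_sub_tendsto_zero.2 ?_
  have e : ∀ s, ‖k s - k t‖ = √(⟪k s, k s⟫_ℂ - ⟪k s, k t⟫_ℂ - ⟪k t, k s⟫_ℂ + ⟪k t, k t⟫_ℂ).re := by
    intro s
    rw [norm_eq_sqrt_re_inner (𝕜 := ℂ), inner_sub_sub_self]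
    rfl
  simp_rw [e]
  have hc : Continuous fun s => √(⟪k s, k s⟫_ℂ - ⟪k s, k t⟫_ℂ - ⟪k t, k s⟫_ℂ + ⟪k t, k t⟫_ℂ).re := by
    have h1 : Continuous fun s => ⟪k s, k s⟫_ℂ := hk.comp (continuous_id.prodMk continuous_id)
    have h2 : Continuous fun s => ⟪k s, k t⟫_ℂ := hk.comp (continuous_id.prodMk continuous_const)
    have h3 : Continuous fun s => ⟪k t, k s⟫_ℂ := hk.comp (continuous_const.prodMk continuous_id)
    fun_prop
  exact hc.tendsto' _ _ (by simp)

/-- A Nevanlinna function with power asymptotics along the imaginary axis, with exponent in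
`(-1, 0)`, has the `B_∞`-property. -/
theorem IsNevanlinna.hasBInftyProperty {m : ℂ → ℂ} (hm : IsNevanlinna m) {α C : ℝ} (hα₀ : 0 < α)
    (hα₁ : α < 1) (hC : 0 < C)
    (hasymp : Tendsto (fun r : ℝ => m (r * I) / ((C : ℂ) / (-((r : ℂ) * I)) ^ (α : ℂ))) atTop
      (𝓝 1)) : HasBInftyProperty m := by
  have hF : Fact (nevanlinnaKernel m).PosSemidef := ⟨hm.posSemidef_kernel⟩
  refine ⟨hF, ?_⟩
  obtain ⟨D, hD0, hD⟩ := hm.exists_norm_apply_I_le hC hasymp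
  obtain ⟨W, hW0, hW⟩ := hm.exists_weight_le hα₀ hα₁ hC hasymp
  have hw : ContinuousOn (weight m) (Set.Ici 1) :=
    (hm.continuousOn_weight fun y hy => hm.im_apply_I_pos hα₀ hα₁ hC hasymp hy).mono
      (Set.Ici_subset_Ioi.2 one_pos)
  -- By the reproducing property `⟪k y, h⟫ = h (iy)` for `y ≥ 1`. The cut-off at `1` makes `k`
  -- continuous on all of `ℝ`.
  set k : ℝ → RKHS.OfKernel (nevanlinnaKernel m) := fun y =>
    RKHS.kerFun (RKHS.OfKernel (nevanlinnaKernel m)) (imagPointMax y) 1 with hkdef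
  have hgram : ∀ y s, ⟪k y, k s⟫_ℂ =
      (m ((max y 1 : ℝ) * I) - conj (m ((max s 1 : ℝ) * I))) / ((max y 1 + max s 1 : ℝ) * I) := by
    intro y s
    rw [hkdef]
    simp only
    rw [RKHS.kerFun_inner, RKHS.kerFun_apply, RKHS.OfKernel.kernel_ofKernel,
      nevanlinnaKernel_apply, RCLike.inner_apply, map_one, mul_one, mul_one, imagPointMax,
      imagPointMax, nevanlinnaKernelFun_I (by positivity) (by positivity)]
  have hk : Continuous k := by
    refine continuous_of_continuous_gram ?_
    simp_rw [hgram]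
    have hmc : Continuous fun y : ℝ => m ((max y 1 : ℝ) * I) :=
      hm.continuousOn_apply_I.comp_continuous (f := fun y : ℝ => max y 1) (by fun_prop)
        fun y => Set.mem_Ioi.2 (by positivity)
    refine Continuous.div ((hmc.comp continuous_fst).sub
      (Complex.continuous_conj.comp (hmc.comp continuous_snd))) (by fun_prop) fun p => ?_
    exact mul_ne_zero (ofReal_ne_zero.2 (by positivity)) I_ne_zero
  obtain ⟨G, hG⟩ := exists_continuousLinearMap_weightMeasure hα₀ hα₁ hw hW0 hD0 hW hk
    fun y s hy hs => by
      have hy0 : 0 < y := by linarith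
      have hs0 : 0 < s := by linarith
      rw [hgram, max_eq_left hy.le, max_eq_left hs.le, norm_div, norm_mul, norm_I, mul_one,
        norm_real, Real.norm_of_nonneg (by positivity), ← mul_div_assoc]
      gcongr
      refine (norm_sub_le _ _).trans ?_
      rw [RCLike.norm_conj, mul_add]
      exact add_le_add (hD y hy.le) (hD s hs.le)
  refine ⟨G, fun h => ?_⟩
  filter_upwards [hG h] with y hy h1
  have e : imagPointMax y = imagPoint y h1 := by
    simp only [imagPointMax, imagPoint, max_eq_left h1.le]
  rw [hy, hkdef]
  simp only
  rw [RKHS.kerFun_inner, e, RCLike.inner_apply, map_one, mul_one]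

/-! ### The integral operator on `L²_σ` -/

namespace IsStieltjesRepresentation

variable {m : ℂ → ℂ} {γ : ℝ} {σ : Measure ℝ}

lemma ae_nonneg (h : IsStieltjesRepresentation m γ σ) : ∀ᵐ t ∂σ, 0 ≤ t := by
  rw [ae_iff]
  simp only [not_le]
  exact h.support

lemma integrable_one_div_add (h : IsStieltjesRepresentation m γ σ) {y : ℝ} (hy : 1 ≤ y) :
    Integrable (fun t : ℝ => 1 / (t + y)) σ := by
  refine h.integrable.mono' (Measurable.aestronglyMeasurable (by fun_prop)) ?_
  filter_upwards [h.ae_nonneg] with t ht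
  rw [Real.norm_of_nonneg (by positivity)]
  gcongr 1 / ?_
  linarith

/-- For `t ≥ 0`, `1 / (t + y) ≤ (t + y) / (t² + y²)`, which is the sum of the real and imaginary
parts of `1 / (t - iy)`. Integration gives at most `Re m (iy) + Im m (iy)`, since `γ ≥ 0`. -/
lemma integral_one_div_add_le (h : IsStieltjesRepresentation m γ σ) {y : ℝ} (hy : 1 ≤ y) :
    ∫ t, 1 / (t + y) ∂σ ≤ 2 * ‖m (y * I)‖ := by
  have hy0 : 0 < y := by linarith
  have hint : Integrable (fun t : ℝ => 1 / ((t : ℂ) - y * I)) σ := by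
    refine (h.integrable.const_mul 2).mono' (Measurable.aestronglyMeasurable (by fun_prop)) ?_
    filter_upwards [h.ae_nonneg] with t ht
    have h1 := abs_re_le_norm ((t : ℂ) - y * I)
    have h2 := abs_im_le_norm ((t : ℂ) - y * I)
    simp only [sub_re, ofReal_re, mul_re, I_re, mul_zero, ofReal_im, I_im, mul_one, sub_self,
      sub_zero, sub_im, mul_im, add_zero, zero_sub, abs_neg, abs_of_nonneg ht,
      abs_of_nonneg hy0.le] at h1 h2
    -- Both `t` and `y ≥ 1` are at most `|t - iy|`, so `1 + t ≤ 2 |t - iy|`.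
    rw [norm_div, norm_one, mul_one_div, div_le_div_iff₀ (by linarith) (by linarith)]
    linarith
  have hz : ((y : ℂ) * I) ∈ cutPlane := fun h' => by simp [hy0.ne'] at h'
  have hre := integral_re hint
  have him := integral_im hint
  have hm := h.eq_integral _ hz
  set J := ∫ t : ℝ, 1 / ((t : ℂ) - y * I) ∂σ
  have hJ : ∫ t, 1 / (t + y) ∂σ ≤ J.re + J.im := by
    change _ ≤ RCLike.re J + RCLike.im J
    rw [← hre, ← him, ← integral_add hint.re hint.im]
    refine integral_mono_ae (h.integrable_one_div_add hy) (hint.re.add hint.im) ?_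
    filter_upwards [h.ae_nonneg] with t ht
    have e : (1 / ((t : ℂ) - y * I)) = ((t / (t ^ 2 + y ^ 2) : ℝ) : ℂ) +
        ((y / (t ^ 2 + y ^ 2) : ℝ) : ℂ) * I := by
      have h1 : (t : ℂ) - y * I ≠ 0 := fun h' => by
        have := congrArg im h'
        simp [hy0.ne'] at this
      have h2 : ((t : ℂ) ^ 2 + y ^ 2) ≠ 0 := by
        have : (0 : ℝ) < t ^ 2 + y ^ 2 := by positivity
        exact_mod_cast this.ne'
      push_cast
      field_simp
      linear_combination ((y : ℂ) ^ 2) * I_sq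
    have e1 : (1 / ((t : ℂ) - y * I)).re = t / (t ^ 2 + y ^ 2) := by
      rw [e]; simp [-ofReal_div]
    have e2 : (1 / ((t : ℂ) - y * I)).im = y / (t ^ 2 + y ^ 2) := by
      rw [e]; simp [-ofReal_div]
    change 1 / (t + y) ≤ (1 / ((t : ℂ) - y * I)).re + (1 / ((t : ℂ) - y * I)).im
    rw [e1, e2, ← add_div, div_le_div_iff₀ (by positivity) (by positivity)]
    nlinarith [mul_nonneg ht hy0.le]
  have h1 := (le_abs_self _).trans (abs_re_le_norm (m (y * I)))
  have h2 := (le_abs_self _).trans (abs_im_le_norm (m (y * I)))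
  have h3 : (m (y * I)).re = γ + J.re := by rw [hm]; simp
  have h4 : (m (y * I)).im = J.im := by rw [hm]; simp
  have := h.nonneg
  linarith

/-- On the support of `σ` the function takes values in `[0, 1]`, so its square is dominated by
itself. -/
lemma memLp_one_div_add (h : IsStieltjesRepresentation m γ σ) {y : ℝ} (hy : 1 ≤ y) :
    MemLp (fun t : ℝ => ((1 / (t + y) : ℝ) : ℂ)) 2 σ := by
  have hmeas : Measurable fun t : ℝ => 1 / (t + y) := by fun_prop
  refine MemLp.ofReal (f := fun t : ℝ => 1 / (t + y))
    ((memLp_two_iff_integrable_sq hmeas.aestronglyMeasurable).2 ?_)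
  refine (h.integrable_one_div_add hy).mono' (hmeas.pow_const 2).aestronglyMeasurable ?_
  filter_upwards [h.ae_nonneg] with t ht
  rw [Real.norm_of_nonneg (by positivity)]
  refine pow_le_of_le_one (by positivity) ?_ two_ne_zero
  rw [div_le_one (by positivity)]
  linarith

/-- The element `x ↦ 1 / (x + y)` of `L²_σ`, with `y` replaced by `1` if `y < 1`. -/
def cauchyVec (h : IsStieltjesRepresentation m γ σ) (y : ℝ) : Lp ℂ 2 σ :=
  (h.memLp_one_div_add (le_max_right y 1)).toLp _

lemma coeFn_cauchyVec (h : IsStieltjesRepresentation m γ σ) (y : ℝ) :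
    h.cauchyVec y =ᵐ[σ] fun t : ℝ => ((1 / (t + max y 1) : ℝ) : ℂ) :=
  MemLp.coeFn_toLp _

/-- The family is Lipschitz: for `y, s ≥ 1` and `t ≥ 0` one has `(t + y) (t + s) ≥ t + 1`, so the
difference is pointwise at most `|y - s| / (t + 1)`. -/
lemma continuous_cauchyVec (h : IsStieltjesRepresentation m γ σ) : Continuous h.cauchyVec := by
  have hle : ∀ y s, ‖h.cauchyVec y - h.cauchyVec s‖ ≤ |max y 1 - max s 1| * ‖h.cauchyVec 1‖ := by
    intro y s
    refine Lp.norm_le_mul_norm_of_ae_le_mul ?_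
    filter_upwards [h.ae_nonneg, Lp.coeFn_sub (h.cauchyVec y) (h.cauchyVec s),
      h.coeFn_cauchyVec y, h.coeFn_cauchyVec s, h.coeFn_cauchyVec 1] with t ht h0 h1 h2 h3
    rw [h0, Pi.sub_apply, h1, h2, h3, ← ofReal_sub, norm_real, norm_real, max_self,
      Real.norm_of_nonneg (by positivity : 0 ≤ 1 / (t + 1)), Real.norm_eq_abs]
    have hy : 1 ≤ max y 1 := le_max_right _ _
    have hs : 1 ≤ max s 1 := le_max_right _ _
    have e : 1 / (t + max y 1) - 1 / (t + max s 1) =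
        -(max y 1 - max s 1) * (1 / ((t + max y 1) * (t + max s 1))) := by
      field_simp
      ring
    rw [e, abs_mul, abs_neg,
      abs_of_nonneg (by positivity : 0 ≤ 1 / ((t + max y 1) * (t + max s 1)))]
    gcongr
    nlinarith
  refine continuous_iff_continuousAt.2 fun s => tendsto_iff_norm_sub_tendsto_zero.2 ?_
  refine squeeze_zero (fun _ => norm_nonneg _) (fun y => hle y s) ?_
  have hc : Continuous fun y => |max y 1 - max s 1| * ‖h.cauchyVec 1‖ := by fun_prop
  exact hc.tendsto' _ _ (by simp)

lemma inner_cauchyVec (h : IsStieltjesRepresentation m γ σ) {y : ℝ} (hy : 1 ≤ y) (f : Lp ℂ 2 σ) :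
    ⟪h.cauchyVec y, f⟫_ℂ = ∫ x : ℝ, f x / ((x : ℂ) + y) ∂σ := by
  rw [L2.inner_def]
  refine integral_congr_ae ?_
  filter_upwards [h.coeFn_cauchyVec y] with x hx
  rw [hx, RCLike.inner_apply, conj_ofReal, max_eq_left hy]
  push_cast
  ring

/-- Pointwise, `1 / (t + y) + 1 / (t + s) = (2t + y + s) / ((t + y) (t + s))`, and the numerator is
at least `y + s` for `t ≥ 0`. This brings the Gram kernel to the same form as that of `H(m)`. -/
lemma norm_inner_cauchyVec_le (h : IsStieltjesRepresentation m γ σ) {y s : ℝ} (hy : 1 ≤ y)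
    (hs : 1 ≤ s) : ‖⟪h.cauchyVec y, h.cauchyVec s⟫_ℂ‖ ≤
      (∫ t, 1 / (t + y) ∂σ + ∫ t, 1 / (t + s) ∂σ) / (y + s) := by
  rw [h.inner_cauchyVec hy, ← integral_add (h.integrable_one_div_add hy)
    (h.integrable_one_div_add hs), ← integral_div]
  refine norm_integral_le_of_norm_le
    (((h.integrable_one_div_add hy).add (h.integrable_one_div_add hs)).div_const _) ?_
  filter_upwards [h.ae_nonneg, h.coeFn_cauchyVec s] with t ht hts
  rw [hts, max_eq_left hs, norm_div, ← ofReal_add, norm_real, norm_real,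
    Real.norm_of_nonneg (by positivity), Real.norm_of_nonneg (by positivity),
    div_add_div _ _ (by positivity) (by positivity), div_div, div_div,
    div_le_div_iff₀ (by positivity) (by positivity)]
  have : 0 ≤ 2 * t * ((t + s) * (t + y)) := by positivity
  nlinarith

/-- The integral operator with kernel `1 / (x + y)` is bounded from `L²_σ` into the weighted space
if `m` has the given power asymptotics along the imaginary axis. -/
theorem stieltjesOperatorBounded (h : IsStieltjesRepresentation m γ σ) (hm : IsNevanlinna m)
    {α C : ℝ} (hα₀ : 0 < α) (hα₁ : α < 1) (hC : 0 < C)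
    (hasymp : Tendsto (fun r : ℝ => m (r * I) / ((C : ℂ) / (-((r : ℂ) * I)) ^ (α : ℂ))) atTop
      (𝓝 1)) : StieltjesOperatorBounded m σ := by
  obtain ⟨D, hD0, hD⟩ := hm.exists_norm_apply_I_le hC hasymp
  obtain ⟨W, hW0, hW⟩ := hm.exists_weight_le hα₀ hα₁ hC hasymp
  have hw : ContinuousOn (weight m) (Set.Ici 1) :=
    (hm.continuousOn_weight fun y hy => hm.im_apply_I_pos hα₀ hα₁ hC hasymp hy).mono
      (Set.Ici_subset_Ioi.2 one_pos)
  obtain ⟨H, hH⟩ := exists_continuousLinearMap_weightMeasure (B := 2 * D) hα₀ hα₁ hw hW0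
    (by positivity) hW h.continuous_cauchyVec fun y s hy hs => by
      refine (h.norm_inner_cauchyVec_le hy.le hs.le).trans ?_
      rw [← mul_div_assoc]
      gcongr
      have h1 := h.integral_one_div_add_le hy.le
      have h2 := h.integral_one_div_add_le hs.le
      have h3 := hD y hy.le
      have h4 := hD s hs.le
      linarith
  refine ⟨H, fun f => ?_⟩
  filter_upwards [hH f, ae_weightMeasure_one_lt m] with y hy h1
  rw [hy, h.inner_cauchyVec h1.le]

end IsStieltjesRepresentation

end

theorem mainTheorem5 (m : ℂ → ℂ) (hm : IsStieltjes m) (α C : ℝ) (hα₀ : 0 < α) (hα₁ : α < 1)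
    (hC : 0 < C)
    (hasymp : ∀ z : ℂ, z.im ≠ 0 →
      Tendsto (fun r : ℝ => m (r * z) / ((C : ℂ) / (-((r : ℂ) * z)) ^ (α : ℂ))) atTop (𝓝 1)) :
    HasBInftyProperty m ∧
      ∀ (γ : ℝ) (σ : Measure ℝ), IsStieltjesRepresentation m γ σ →
        StieltjesOperatorBounded m σ := by
  have hI := hasymp Complex.I (by simp)
  exact ⟨hm.toIsNevanlinna.hasBInftyProperty hα₀ hα₁ hC hI, fun γ σ h =>
    h.stieltjesOperatorBounded hm.toIsNevanlinna hα₀ hα₁ hC hI⟩
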